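/- Let $X=(\mathcal A,\mathcal H,\pi,D)$ be a compact spectral metric space. That is: $\mathcal A$ is a separable unital $C^*$-algebra, $\pi$ is a faithful non-degenerate representation of $\mathcal A$ on a Hilbert space $\mathcal H$, and $D$ is a selfadjoint operator on $\mathcal H$ with compact resolvent such that * $C^1(X)=\{a\in\mathcal A:\ [D,\pi(a)]\text{ is bounded}\}$ is dense in $\mathcal A$; * the metric commutant $\mathcal A_D'=\{a\in\mathcal A:\ [D,\pi(a)]=0\}$ equals $\mathbb C\mathbf 1$; * for some strictly positive element $h\in\mathcal A$ (i.e. $h\ge 0$ with $h\mathcal A h$ dense in $\mathcal A$), the compressed Lipschitz ball $h\,B_{\mathrm{Lip}}(X)\,h$, where $B_{\mathrm{Lip}}(X)=\{a\in\mathcal A:\ \|[D,\pi(a)]\|\le 1\}$, has precompact image in $\mathcal A/\mathcal A_D'$. Let $\alpha$ be a $*$-automorphism of $\mathcal A$ generating an equicontinuous group: $\sup_{n\in\mathbb Z}\|[D,\pi(\alpha^n(a))]\|<\infty$ for every $a\in C^1(X)$. Let $\mathcal A\rtimes_\alpha\mathbb Z$ be the full crossed product, i.e. the universal $C^*$-algebra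 generated by $\mathcal A$ and a unitary $u$ with $uau^{-1}=\alpha(a)$. Let $\mathcal K=\mathcal H\otimes\ell^2(\mathbb Z)\otimes\mathbb C^2$, written as sequences $f=(f_n)_{n\in\mathbb Z}$ with $f_n\in\mathcal H\otimes\mathbb C^2$. Let $\hat\pi$ be the left regular representation of $\mathcal A\rtimes_\alpha\mathbb Z$ on $\mathcal K$, determined by $$(\hat\pi(a)f)_n=\pi(\alpha^{-n}(a))f_n\quad(a\in\mathcal A),\qquad (\hat\pi(u)f)_n=f_{n-1},$$ and let $\widehat D$ be the operator on $\mathcal K$, with its maximal domain, given by $$(\widehat Df)_n=\begin{pmatrix}0&D-\imath n\\ D+\imath n&0\end{pmatrix}f_n .$$ Let $Y=X\rtimes_\alpha\mathbb Z=(\mathcal A\rtimes_\alpha\mathbb Z,\mathcal K,\hat\pi,\widehat D)$ be the regular representation of $(X,\alpha)$. Then the image of the Lipschitz ball $\{b\in\mathcal A\rtimes_\alpha\mathbb Z:\ \|[\widehat D,\hat\pi(b)]\|\le 1\}$ in the quotient of $\mathcal A\rtimes_\alpha\mathbb Z$ by the $\widehat D$-commutant $\{b:\ [\widehat D,\hat\pi(b)]=0\}$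 is compact. Moreover, $Y$ is a compact spectral metric space. -/

import Mathlib

noncomputable section

namespace CrossedProductZ

variable {A : Type*} [CStarAlgebra A]

/-- The C⋆-algebra `A`, regarded as carrying the action `n ↦ αⁿ` of `ℤ` (written
multiplicatively). -/
def Coeff (_α : A ≃⋆ₐ[ℂ] A) : Type _ := A

variable (α : A ≃⋆ₐ[ℂ] A)

instance : CStarAlgebra (Coeff α) := inferInstanceAs (CStarAlgebra A)

instance : MulSemiringAction (Multiplicative ℤ) (Coeff α) where
  smul n a := (α ^ n.toAdd) a
  one_smul a := by change (α ^ (0 : ℤ)) a = a; rw [zpow_zero]; rfl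
  mul_smul m n a := by
    change (α ^ (m.toAdd + n.toAdd)) a = (α ^ m.toAdd) ((α ^ n.toAdd) a)
    rw [zpow_add]; rfl
  smul_zero n := map_zero (α ^ n.toAdd)
  smul_add n := map_add (α ^ n.toAdd)
  smul_one n := map_one (α ^ n.toAdd)
  smul_mul n := map_mul (α ^ n.toAdd)

theorem smul_def (n : Multiplicative ℤ) (a : Coeff α) : n • a = (α ^ n.toAdd) a := rfl

theorem smul_star (n : Multiplicative ℤ) (a : Coeff α) : n • star a = star (n • a) :=
  map_star (α ^ n.toAdd) a

theorem norm_smul_eq (n : Multiplicative ℤ) (a : Coeff α) : ‖n • a‖ = ‖a‖ :=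
  StarAlgEquiv.norm_map (α ^ n.toAdd) a

instance : SMulCommClass (Multiplicative ℤ) ℂ (Coeff α) where
  smul_comm n c a := map_smul (α ^ n.toAdd) c a

/-- `C_c(ℤ, A)`: finite sums `∑ aₙ uⁿ` with `(a uᵐ)(b uⁿ) = a αᵐ(b) uᵐ⁺ⁿ`. The monomial
`a uⁿ` is `SkewMonoidAlgebra.single (Multiplicative.ofAdd n) a`. -/
abbrev FiniteSums : Type _ := SkewMonoidAlgebra (Coeff α) (Multiplicative ℤ)

open SkewMonoidAlgebra

/-- The involution: `(a uⁿ)⋆ = u⁻ⁿ a⋆ = α⁻ⁿ(a⋆) u⁻ⁿ`. -/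
instance : Star (FiniteSums α) where
  star f := f.sum fun n a => single n⁻¹ (n⁻¹ • star a)

theorem star_single (n : Multiplicative ℤ) (a : Coeff α) :
    star (single n a : FiniteSums α) = single n⁻¹ (n⁻¹ • star a) :=
  sum_single_index (by simp)

theorem star_add_aux (f g : FiniteSums α) : star (f + g) = star f + star g :=
  sum_add_index (by simp) (by simp [smul_add, single_add])

instance : StarRing (FiniteSums α) where
  star_involutive f := by
    induction f using SkewMonoidAlgebra.induction_on' with
    | single n a => simp [star_single, smul_star]
    | add f g hf hg => rw [star_add_aux, star_add_aux, hf, hg]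
  star_add := star_add_aux α
  star_mul f g := by
    induction f using SkewMonoidAlgebra.induction_on' with
    | add f₁ f₂ h₁ h₂ => rw [add_mul, star_add_aux, star_add_aux, mul_add, h₁, h₂]
    | single m a =>
      induction g using SkewMonoidAlgebra.induction_on' with
      | add g₁ g₂ h₁ h₂ => rw [mul_add, star_add_aux, star_add_aux, add_mul, h₁, h₂]
      | single n b =>
        simp only [single_mul_single, star_single, star_mul, smul_mul', mul_inv_rev, mul_smul,
          ← smul_star, inv_smul_smul]

instance : StarModule ℂ (FiniteSums α) where
  star_smul c f := by
    induction f using SkewMonoidAlgebra.induction_on' with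
    | add f g hf hg => rw [smul_add, star_add, star_add, smul_add, hf, hg]
    | single n a => rw [smul_single, star_single, star_single, smul_single, star_smul, smul_comm]

/-- The `ℓ¹`-norm `∑ ‖aₙ‖`. -/
def l1Norm (f : FiniteSums α) : ℝ := f.sum fun _ a => ‖a‖

/-- C⋆-seminorms on `C_c(ℤ, A)` dominated by the `ℓ¹`-norm. -/
structure IsCStarSeminorm (p : Seminorm ℂ (FiniteSums α)) : Prop where
  mul_le : ∀ f g, p (f * g) ≤ p f * p g
  star_mul_self : ∀ f, p (star f * f) = p f * p f
  le_l1Norm : ∀ f, p f ≤ l1Norm α f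

/-- The norm of the full crossed product: the largest of these C⋆-seminorms. -/
def maxNorm (f : FiniteSums α) : ℝ :=
  ⨆ p : {p : Seminorm ℂ (FiniteSums α) // IsCStarSeminorm α p}, p.1 f

instance : Nonempty {p : Seminorm ℂ (FiniteSums α) // IsCStarSeminorm α p} :=
  ⟨0, by simp, by simp, fun f => Finset.sum_nonneg fun _ _ => norm_nonneg _⟩

theorem bddAbove_range (f : FiniteSums α) :
    BddAbove (Set.range fun p : {p : Seminorm ℂ (FiniteSums α) // IsCStarSeminorm α p} => p.1 f) :=
  ⟨l1Norm α f, by rintro _ ⟨p, rfl⟩; exact p.2.le_l1Norm f⟩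

theorem le_maxNorm {p : Seminorm ℂ (FiniteSums α)} (hp : IsCStarSeminorm α p)
    (f : FiniteSums α) : p f ≤ maxNorm α f :=
  le_ciSup (bddAbove_range α f) ⟨p, hp⟩

theorem maxNorm_le {f : FiniteSums α} {C : ℝ}
    (h : ∀ p : Seminorm ℂ (FiniteSums α), IsCStarSeminorm α p → p f ≤ C) : maxNorm α f ≤ C :=
  ciSup_le fun p => h p.1 p.2

theorem maxNorm_nonneg (f : FiniteSums α) : 0 ≤ maxNorm α f :=
  Real.iSup_nonneg fun p => apply_nonneg p.1 f

theorem maxNorm_star_mul_self (f : FiniteSums α) :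
    maxNorm α (star f * f) = maxNorm α f * maxNorm α f := by
  apply le_antisymm
  · refine maxNorm_le α fun p hp => ?_
    rw [hp.star_mul_self]
    exact mul_self_le_mul_self (apply_nonneg p f) (le_maxNorm α hp f)
  · have h : maxNorm α f ≤ √(maxNorm α (star f * f)) := maxNorm_le α fun p hp =>
      Real.le_sqrt_of_sq_le (by rw [sq, ← hp.star_mul_self]; exact le_maxNorm α hp _)
    calc maxNorm α f * maxNorm α f
        ≤ √(maxNorm α (star f * f)) * √(maxNorm α (star f * f)) :=
          mul_self_le_mul_self (maxNorm_nonneg α f) h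
      _ = maxNorm α (star f * f) := Real.mul_self_sqrt (maxNorm_nonneg α _)

theorem maxNorm_mul_le (f g : FiniteSums α) :
    maxNorm α (f * g) ≤ maxNorm α f * maxNorm α g :=
  maxNorm_le α fun p hp => (hp.mul_le f g).trans
    (mul_le_mul (le_maxNorm α hp f) (le_maxNorm α hp g) (apply_nonneg p g) (maxNorm_nonneg α f))

theorem maxNorm_smul (c : ℂ) (f : FiniteSums α) : maxNorm α (c • f) = ‖c‖ * maxNorm α f := by
  simp only [maxNorm, map_smul_eq_mul]
  exact (Real.mul_iSup_of_nonneg (norm_nonneg c) _).symm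

/-- `C_c(ℤ, A)` with the norm `maxNorm`. -/
def NormedFiniteSums : Type _ := FiniteSums α

instance : Ring (NormedFiniteSums α) := inferInstanceAs (Ring (FiniteSums α))

instance : Algebra ℂ (NormedFiniteSums α) := inferInstanceAs (Algebra ℂ (FiniteSums α))

instance : StarRing (NormedFiniteSums α) := inferInstanceAs (StarRing (FiniteSums α))

instance : SeminormedRing (NormedFiniteSums α) :=
  RingSeminorm.toSeminormedRing (R := NormedFiniteSums α)
    { toFun := maxNorm α
      map_zero' := by
        refine le_antisymm (maxNorm_le α fun p _ => ?_) (maxNorm_nonneg α _)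
        exact (map_zero p).le
      add_le' := fun f g => maxNorm_le α fun p hp => (map_add_le_add p (f : FiniteSums α) g).trans
        (add_le_add (le_maxNorm α hp f) (le_maxNorm α hp g))
      neg' := fun f => congrArg iSup (funext fun p => map_neg_eq_map p.1 (f : FiniteSums α))
      mul_le' := maxNorm_mul_le α }

instance : NormedAlgebra ℂ (NormedFiniteSums α) where
  norm_smul_le c f := (maxNorm_smul α c f).le

theorem maxNorm_star_le (f : FiniteSums α) : maxNorm α (star f) ≤ maxNorm α f := by
  have h : maxNorm α (star f) * maxNorm α (star f) ≤ maxNorm α f * maxNorm α (star f) := by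
    have := maxNorm_star_mul_self α (star f)
    rw [star_star] at this
    exact this.symm.le.trans (maxNorm_mul_le α f (star f))
  rcases (maxNorm_nonneg α (star f)).eq_or_lt with h0 | h0
  · rw [← h0]; exact maxNorm_nonneg α f
  · exact le_of_mul_le_mul_right h h0

instance : NormedStarGroup (NormedFiniteSums α) := ⟨maxNorm_star_le α⟩

end CrossedProductZ

/-- The crossed product `A ⋊_α ℤ`: the completion of `C_c(ℤ, A)` for the largest C⋆-seminorm
dominated by the `ℓ¹`-norm, i.e. the enveloping C⋆-algebra of `ℓ¹(ℤ, A)`. This is the universal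
C⋆-algebra generated by `A` and a unitary `u` with `u a u⁻¹ = α(a)`. -/
def CrossedProductZ {A : Type*} [CStarAlgebra A] (α : A ≃⋆ₐ[ℂ] A) : Type _ :=
  UniformSpace.Completion (CrossedProductZ.NormedFiniteSums α)

namespace CrossedProductZ
open UniformSpace
variable {A : Type*} [CStarAlgebra A] (α : A ≃⋆ₐ[ℂ] A)

instance : NormedRing (CrossedProductZ α) :=
  inferInstanceAs (NormedRing (Completion (NormedFiniteSums α)))
instance : CompleteSpace (CrossedProductZ α) :=
  inferInstanceAs (CompleteSpace (Completion (NormedFiniteSums α)))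

/-- The canonical map from `C_c(ℤ, A)`, with dense range. -/
def of (f : FiniteSums α) : CrossedProductZ α :=
  ((show NormedFiniteSums α from f) : Completion (NormedFiniteSums α))

instance : Algebra ℂ (CrossedProductZ α) :=
  inferInstanceAs (Algebra ℂ (Completion (NormedFiniteSums α)))

instance : NormedAlgebra ℂ (CrossedProductZ α) where
  norm_smul_le := norm_smul_le (α := ℂ) (β := Completion (NormedFiniteSums α))

instance : Star (CrossedProductZ α) where
  star := Completion.map (star : NormedFiniteSums α → NormedFiniteSums α)

theorem denseRange_of : DenseRange (of α) :=
  Completion.denseRange_coe (α := NormedFiniteSums α)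

theorem of_add (f g : FiniteSums α) : of α (f + g) = of α f + of α g :=
  Completion.coe_add (α := NormedFiniteSums α) f g

theorem of_mul (f g : FiniteSums α) : of α (f * g) = of α f * of α g :=
  Completion.coe_mul (α := NormedFiniteSums α) f g

theorem of_smul (c : ℂ) (f : FiniteSums α) : of α (c • f) = c • of α f :=
  Completion.coe_smul (X := NormedFiniteSums α) c f

theorem norm_of (f : FiniteSums α) : ‖of α f‖ = maxNorm α f :=
  Completion.norm_coe (E := NormedFiniteSums α) f

theorem of_star (f : FiniteSums α) : of α (star f) = star (of α f) :=
  (Completion.map_coe (α := NormedFiniteSums α) (β := NormedFiniteSums α)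
    (starNormedAddGroupHom (E := NormedFiniteSums α)).uniformContinuous f).symm

theorem continuous_star' : Continuous (star : CrossedProductZ α → CrossedProductZ α) :=
  Completion.continuous_map

/-- A closed condition on the crossed product holds everywhere if it holds on `C_c(ℤ, A)`. -/
theorem induction_of {p : CrossedProductZ α → Prop} (hc : IsClosed {b | p b})
    (h : ∀ f, p (of α f)) (b : CrossedProductZ α) : p b :=
  Completion.induction_on (α := NormedFiniteSums α) b hc h

theorem induction_of₂ {p : CrossedProductZ α → CrossedProductZ α → Prop}
    (hc : IsClosed {b : CrossedProductZ α × CrossedProductZ α | p b.1 b.2})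
    (h : ∀ f g, p (of α f) (of α g)) (b c : CrossedProductZ α) : p b c :=
  Completion.induction_on₂ (α := NormedFiniteSums α) (β := NormedFiniteSums α) b c hc h

instance : StarRing (CrossedProductZ α) where
  star_involutive b := by
    induction b using induction_of with
    | hc => exact isClosed_eq ((continuous_star' α).comp (continuous_star' α)) continuous_id
    | h f => rw [← of_star, ← of_star, star_star]
  star_add b c := by
    induction b, c using induction_of₂ with
    | hc =>
      have := continuous_star' α
      exact isClosed_eq (by fun_prop) (by fun_prop)
    | h f g => rw [← of_add, ← of_star, star_add, of_add, of_star, of_star]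
  star_mul b c := by
    induction b, c using induction_of₂ with
    | hc =>
      have := continuous_star' α
      exact isClosed_eq (by fun_prop) (by fun_prop)
    | h f g => rw [← of_mul, ← of_star, star_mul, of_mul, of_star, of_star]

instance : StarModule ℂ (CrossedProductZ α) where
  star_smul c b := by
    induction b using induction_of with
    | hc =>
      exact isClosed_eq ((continuous_star' α).comp (continuous_const_smul c))
        ((continuous_const_smul (star c)).comp (continuous_star' α))
    | h f => rw [← of_smul, ← of_star, star_smul, of_smul, of_star]

instance : CStarRing (CrossedProductZ α) where
  norm_mul_self_le b := by
    induction b using induction_of with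
    | hc =>
      have := continuous_star' α
      exact isClosed_le (by fun_prop) (by fun_prop)
    | h f => rw [← of_star, ← of_mul, norm_of, norm_of, maxNorm_star_mul_self]

instance : CStarAlgebra (CrossedProductZ α) where

end CrossedProductZ

/-! ### Spectral triples and spectral metric spaces -/

/-- The data `(A, H, π, D)` underlying a spectral triple: a representation `π` of `A` on `H` and a
partially defined operator `D`. -/
structure SpectralData (A : Type*) [CStarAlgebra A] (H : Type*) [NormedAddCommGroup H]
    [InnerProductSpace ℂ H] [CompleteSpace H] where
  rep : A →⋆ₙₐ[ℂ] (H →L[ℂ] H)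
  dirac : H →ₗ.[ℂ] H

/-- `b` preserves the domain of `D` and the bounded operator `T` extends `[D, b] = D b - b D`.
For closed `D` this is the same as asking it on some core of `D` invariant under `b`. -/
def IsCommutator {H : Type*} [NormedAddCommGroup H] [InnerProductSpace ℂ H]
    (D : H →ₗ.[ℂ] H) (b T : H →L[ℂ] H) : Prop :=
  ∀ x : D.domain, ∃ h : b x ∈ D.domain, D ⟨b x, h⟩ - b (D x) = T x

/-- `(D - z)⁻¹` exists as a compact operator for some `z`. -/
def HasCompactResolvent {H : Type*} [NormedAddCommGroup H] [InnerProductSpace ℂ H]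
    (D : H →ₗ.[ℂ] H) : Prop :=
  ∃ (z : ℂ) (R : H →L[ℂ] H), IsCompactOperator R ∧
    (∀ y, ∃ h : R y ∈ D.domain, D ⟨R y, h⟩ - z • R y = y) ∧
    ∀ x : D.domain, R (D x - z • (x : H)) = x

/-- A strictly positive element: a positive `h` with `hAh` dense. -/
def IsStrictlyPositiveElement {A : Type*} [CStarAlgebra A] (h : A) : Prop :=
  (∃ x, h = star x * x) ∧ Dense (Set.range fun a => h * a * h)

namespace SpectralData

variable {A : Type*} [CStarAlgebra A] {H : Type*} [NormedAddCommGroup H]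
  [InnerProductSpace ℂ H] [CompleteSpace H] (X : SpectralData A H)

/-- `C¹(X)`, the elements with bounded commutator `[D, a]`. -/
def C1 : Set A := {a | ∃ T, IsCommutator X.dirac (X.rep a) T}

/-- The Lipschitz ball `{a | ‖[D, a]‖ ≤ 1}`. -/
def lipBall : Set A := {a | ∃ T, IsCommutator X.dirac (X.rep a) T ∧ ‖T‖ ≤ 1}

/-- The metric commutant (`D`-commutant) `{a | [D, a] = 0}`. -/
def commutant : Submodule ℂ A where
  carrier := {a | IsCommutator X.dirac (X.rep a) 0}
  zero_mem' x := by
    have h : X.rep 0 (x : H) = 0 := by simp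
    refine ⟨h ▸ X.dirac.domain.zero_mem, ?_⟩
    have : (⟨X.rep 0 (x : H), h ▸ X.dirac.domain.zero_mem⟩ : X.dirac.domain) = 0 := Subtype.ext h
    rw [this]; simp
  add_mem' {a b} ha hb x := by
    obtain ⟨h₁, e₁⟩ := ha x
    obtain ⟨h₂, e₂⟩ := hb x
    have h : X.rep (a + b) (x : H) = X.rep a x + X.rep b x := by simp
    refine ⟨h ▸ X.dirac.domain.add_mem h₁ h₂, ?_⟩
    have e : (⟨X.rep (a + b) (x : H), h ▸ X.dirac.domain.add_mem h₁ h₂⟩ : X.dirac.domain) =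
      ⟨_, h₁⟩ + ⟨_, h₂⟩ := Subtype.ext h
    rw [e, LinearPMap.map_add, map_add, add_apply, add_sub_add_comm, e₁, e₂]
    simp
  smul_mem' c a ha x := by
    obtain ⟨h₁, e₁⟩ := ha x
    have h : X.rep (c • a) (x : H) = c • X.rep a x := by simp
    refine ⟨h ▸ X.dirac.domain.smul_mem c h₁, ?_⟩
    have e : (⟨X.rep (c • a) (x : H), h ▸ X.dirac.domain.smul_mem c h₁⟩ : X.dirac.domain) =
      c • ⟨_, h₁⟩ := Subtype.ext h
    rw [e, LinearPMap.map_smul, map_smul, smul_apply, ← smul_sub, e₁]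
    simp

/-- `(A, H, π, D)` is a spectral triple. The representation is faithful, as `A` is identified
with its image in `B(H)`. -/
structure IsSpectralTriple : Prop where
  separable : TopologicalSpace.SeparableSpace A
  faithful : Function.Injective X.rep
  isSelfAdjoint : IsSelfAdjoint X.dirac
  compactResolvent : HasCompactResolvent X.dirac
  dense_C1 : Dense X.C1

/-- `X` is a compact spectral metric space (`A` being unital): a spectral triple with nondegenerate
representation, trivial metric commutant, and, for some strictly positive `h`, `h`-compressed
Lipschitz ball precompact modulo the metric commutant. -/
structure IsCompactSpectralMetricSpace : Prop extends X.IsSpectralTriple where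
  nondegenerate :
    (Submodule.span ℂ {y : H | ∃ a x, X.rep a x = y}).topologicalClosure = ⊤
  commutant_eq : X.commutant = Submodule.span ℂ {1}
  precompact_lipBall : ∃ h : A, IsStrictlyPositiveElement h ∧
    IsCompact (closure (X.commutant.mkQ '' ((fun a => h * a * h) '' X.lipBall)))

/-- `C_b¹(G, X)`: the `a` with `sup_{g ∈ G} ‖[D, g(a)]‖ < ∞`. -/
def C1b (G : Subgroup (A ≃⋆ₐ[ℂ] A)) : Set A :=
  {a | ∃ C : ℝ, ∀ g ∈ G, ∃ T, IsCommutator X.dirac (X.rep (g a)) T ∧ ‖T‖ ≤ C}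

/-- The group `G` is equicontinuous: `C¹(X) = C_b¹(G, X)`. -/
def IsEquicontinuous (G : Subgroup (A ≃⋆ₐ[ℂ] A)) : Prop := X.C1 = X.C1b G

end SpectralData

/-! ### The regular representation -/

/-- The orthogonal direct sum of a sequence of unbounded operators, on its maximal domain. -/
def LinearPMap.l2Sum {E : Type*} [NormedAddCommGroup E] [InnerProductSpace ℂ E]
    (T : ℤ → E →ₗ.[ℂ] E) : lp (fun _ : ℤ => E) 2 →ₗ.[ℂ] lp (fun _ : ℤ => E) 2 where
  domain :=
    { carrier := {f | ∃ h : ∀ n, f n ∈ (T n).domain, Memℓp (fun n => T n ⟨f n, h n⟩) 2}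
      zero_mem' := ⟨fun n => (T n).domain.zero_mem, by
        convert zero_memℓp (E := fun _ : ℤ => E) with n
        exact (T n).map_zero⟩
      add_mem' := by
        rintro f g ⟨hf, hf'⟩ ⟨hg, hg'⟩
        refine ⟨fun n => (T n).domain.add_mem (hf n) (hg n), ?_⟩
        convert hf'.add hg' with n
        exact (T n).map_add ⟨f n, hf n⟩ ⟨g n, hg n⟩
      smul_mem' := by
        rintro c f ⟨hf, hf'⟩
        refine ⟨fun n => (T n).domain.smul_mem c (hf n), ?_⟩
        convert hf'.const_smul c with n
        exact (T n).map_smul c ⟨f n, hf n⟩ }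
  toFun :=
    { toFun := fun f => ⟨fun n => T n ⟨f.1 n, f.2.1 n⟩, f.2.2⟩
      map_add' := fun f g => by
        ext n; exact (T n).map_add ⟨f.1 n, f.2.1 n⟩ ⟨g.1 n, g.2.1 n⟩
      map_smul' := fun c f => by
        ext n; exact (T n).map_smul c ⟨f.1 n, f.2.1 n⟩ }

namespace SpectralData

/-- The Hilbert space `K = H ⊗ ℓ²(ℤ) ⊗ ℂ²`, realized as `ℓ²(ℤ, H ⊕ H)`. -/
abbrev RegSpace (H : Type*) [NormedAddCommGroup H] [InnerProductSpace ℂ H] : Type _ :=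
  lp (fun _ : ℤ => WithLp 2 (H × H)) 2

/-- The translation by `m`, `(ûᵐ f)ₙ = fₙ₋ₘ`. -/
def shift (H : Type*) [NormedAddCommGroup H] [InnerProductSpace ℂ H] (m : Multiplicative ℤ) :
    RegSpace H →L[ℂ] RegSpace H :=
  LinearMap.mkContinuous
    { toFun := fun f => ⟨fun n => f (n - m.toAdd), by
        have := lp.memℓp f
        rw [memℓp_gen_iff (by norm_num)] at this
        exact (memℓp_gen_iff (by norm_num)).mpr ((Equiv.subRight m.toAdd).summable_iff.mpr this)⟩
      map_add' := fun _ _ => rfl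
      map_smul' := fun _ _ => rfl }
    1 (fun f => by
      rw [one_mul, lp.norm_eq_tsum_rpow (by norm_num), lp.norm_eq_tsum_rpow (by norm_num)]
      exact (congrArg (· ^ _) ((Equiv.subRight m.toAdd).tsum_eq fun n => ‖f n‖ ^ _)).le)

theorem shift_apply {H : Type*} [NormedAddCommGroup H] [InnerProductSpace ℂ H]
    (m : Multiplicative ℤ) (f : RegSpace H) (n : ℤ) :
    shift H m f n = f (n - m.toAdd) := rfl

theorem norm_shift_le {H : Type*} [NormedAddCommGroup H] [InnerProductSpace ℂ H]
    (m : Multiplicative ℤ) : ‖shift H m‖ ≤ 1 :=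
  LinearMap.mkContinuous_norm_le _ zero_le_one _

theorem shift_mul {H : Type*} [NormedAddCommGroup H] [InnerProductSpace ℂ H]
    (m n : Multiplicative ℤ) : shift H (m * n) = shift H m * shift H n :=
  ContinuousLinearMap.ext fun f => lp.ext <| funext fun k => by
    change f (k - (m.toAdd + n.toAdd)) = f (k - m.toAdd - n.toAdd)
    rw [sub_sub]

variable {A : Type*} [CStarAlgebra A] {H : Type*} [NormedAddCommGroup H]
  [InnerProductSpace ℂ H] [CompleteSpace H]

/-- `D ⊗ σ₁ + n 1 ⊗ σ₂` on `H ⊗ ℂ² = H ⊕ H`, that is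
`(v₊, v₋) ↦ (D v₋ - i n v₋, D v₊ + i n v₊)`. -/
def diracBlock (D : H →ₗ.[ℂ] H) (n : ℤ) : WithLp 2 (H × H) →ₗ.[ℂ] WithLp 2 (H × H) where
  domain := (D.domain.prod D.domain).comap (WithLp.linearEquiv 2 ℂ (H × H)).toLinearMap
  toFun :=
    { toFun := fun v => WithLp.toLp 2
        (D ⟨v.1.snd, v.2.2⟩ - (Complex.I * n) • v.1.snd,
          D ⟨v.1.fst, v.2.1⟩ + (Complex.I * n) • v.1.fst)
      map_add' := fun v w => by
        rw [WithLp.ext_iff]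
        exact Prod.ext
          (by
            change D (⟨v.1.snd, v.2.2⟩ + ⟨w.1.snd, w.2.2⟩) - _ • (v.1.snd + w.1.snd) = _ - _ + (_ - _)
            rw [D.map_add, smul_add, add_sub_add_comm])
          (by
            change D (⟨v.1.fst, v.2.1⟩ + ⟨w.1.fst, w.2.1⟩) + _ • (v.1.fst + w.1.fst) = _ + _ + (_ + _)
            rw [D.map_add, smul_add, add_add_add_comm])
      map_smul' := fun c v => by
        rw [WithLp.ext_iff]
        exact Prod.ext
          (by
            change D (c • ⟨v.1.snd, v.2.2⟩) - _ • (c • v.1.snd) = c • (_ - _)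
            rw [D.map_smul, smul_sub, smul_comm])
          (by
            change D (c • ⟨v.1.fst, v.2.1⟩) + _ • (c • v.1.fst) = c • (_ + _)
            rw [D.map_smul, smul_add, smul_comm]) }

/-- `a ↦ π(a) ⊗ 1` on `H ⊗ ℂ² = H ⊕ H`. -/
def doubleRep (π : A →⋆ₙₐ[ℂ] (H →L[ℂ] H)) :
    A →⋆ₙₐ[ℂ] (WithLp 2 (H × H) →L[ℂ] WithLp 2 (H × H)) where
  toFun a := (WithLp.prodContinuousLinearEquiv 2 ℂ H H).symm.toContinuousLinearMap ∘L
    ((π a).prodMap (π a)) ∘L (WithLp.prodContinuousLinearEquiv 2 ℂ H H).toContinuousLinearMap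
  map_smul' c a := by
    refine ContinuousLinearMap.ext fun v => (WithLp.ofLp_injective 2) (Prod.ext ?_ ?_)
    · change π (c • a) v.fst = c • π a v.fst
      simp
    · change π (c • a) v.snd = c • π a v.snd
      simp
  map_zero' := by
    refine ContinuousLinearMap.ext fun v => (WithLp.ofLp_injective 2) (Prod.ext ?_ ?_)
    · change π 0 v.fst = 0
      simp
    · change π 0 v.snd = 0
      simp
  map_add' a b := by
    refine ContinuousLinearMap.ext fun v => (WithLp.ofLp_injective 2) (Prod.ext ?_ ?_)
    · change π (a + b) v.fst = π a v.fst + π b v.fst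
      simp
    · change π (a + b) v.snd = π a v.snd + π b v.snd
      simp
  map_mul' a b := by
    refine ContinuousLinearMap.ext fun v => (WithLp.ofLp_injective 2) (Prod.ext ?_ ?_)
    · change π (a * b) v.fst = π a (π b v.fst)
      simp
    · change π (a * b) v.snd = π a (π b v.snd)
      simp
  map_star' a := by
    rw [ContinuousLinearMap.star_eq_adjoint, ContinuousLinearMap.eq_adjoint_iff]
    intro v w
    rw [WithLp.prod_inner_apply, WithLp.prod_inner_apply]
    change inner ℂ (π (star a) v.fst) w.fst + inner ℂ (π (star a) v.snd) w.snd =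
      inner ℂ v.fst (π a w.fst) + inner ℂ v.snd (π a w.snd)
    rw [map_star, ContinuousLinearMap.star_eq_adjoint, ContinuousLinearMap.adjoint_inner_left,
      ContinuousLinearMap.adjoint_inner_left]

/-- `(π̂(a) f)ₙ = π(α⁻ⁿ(a)) fₙ`. -/
def regRepCoeff (α : A ≃⋆ₐ[ℂ] A) (π : A →⋆ₙₐ[ℂ] (H →L[ℂ] H)) :
    A →⋆ₙₐ[ℂ] (RegSpace H →L[ℂ] RegSpace H) where
  toFun a := lp.mapCLM 2 (fun n : ℤ => doubleRep π ((α ^ (-n)) a)) (norm_nonneg a) fun n =>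
    (NonUnitalStarAlgHom.norm_apply_le (doubleRep π) _).trans
      (StarAlgEquiv.norm_map (α ^ (-n)) a).le
  map_smul' c a := by
    refine ContinuousLinearMap.ext fun f => lp.ext (funext fun n => ?_)
    change doubleRep π ((α ^ (-n)) (c • a)) (f n) = c • doubleRep π ((α ^ (-n)) a) (f n)
    rw [map_smul, map_smul, smul_apply]
  map_zero' := by
    refine ContinuousLinearMap.ext fun f => lp.ext (funext fun n => ?_)
    change doubleRep π ((α ^ (-n)) 0) (f n) = 0
    rw [map_zero, map_zero, zero_apply]
  map_add' a b := by
    refine ContinuousLinearMap.ext fun f => lp.ext (funext fun n => ?_)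
    change doubleRep π ((α ^ (-n)) (a + b)) (f n) =
      doubleRep π ((α ^ (-n)) a) (f n) + doubleRep π ((α ^ (-n)) b) (f n)
    rw [map_add, map_add, add_apply]
  map_mul' a b := by
    refine ContinuousLinearMap.ext fun f => lp.ext (funext fun n => ?_)
    change doubleRep π ((α ^ (-n)) (a * b)) (f n) =
      doubleRep π ((α ^ (-n)) a) (doubleRep π ((α ^ (-n)) b) (f n))
    rw [map_mul, map_mul, mul_apply_eq_comp]
  map_star' a := by
    rw [ContinuousLinearMap.star_eq_adjoint, ContinuousLinearMap.eq_adjoint_iff]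
    intro f g
    rw [lp.inner_eq_tsum, lp.inner_eq_tsum]
    refine tsum_congr fun n => ?_
    change inner ℂ (doubleRep π ((α ^ (-n)) (star a)) (f n)) (g n) =
      inner ℂ (f n) (doubleRep π ((α ^ (-n)) a) (g n))
    rw [map_star, map_star, ContinuousLinearMap.star_eq_adjoint,
      ContinuousLinearMap.adjoint_inner_left]

theorem regRepCoeff_apply (α : A ≃⋆ₐ[ℂ] A) (π : A →⋆ₙₐ[ℂ] (H →L[ℂ] H)) (a : A)
    (f : RegSpace H) (n : ℤ) :
    regRepCoeff α π a f n = doubleRep π ((α ^ (-n)) a) (f n) := rfl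

theorem star_shift (m : Multiplicative ℤ) : star (shift H m) = shift H m⁻¹ := by
  symm
  rw [ContinuousLinearMap.star_eq_adjoint, ContinuousLinearMap.eq_adjoint_iff]
  intro f g
  rw [lp.inner_eq_tsum, lp.inner_eq_tsum, ← (Equiv.subRight m.toAdd).tsum_eq]
  refine tsum_congr fun n => ?_
  change inner ℂ (f (n - m.toAdd - -m.toAdd)) (g (n - m.toAdd)) = inner ℂ (f n) (g (n - m.toAdd))
  rw [sub_neg_eq_add, sub_add_cancel]

/-- The covariance relation `ûᵐ π̂(a) = π̂(αᵐ(a)) ûᵐ`. -/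
theorem shift_mul_regRepCoeff (α : A ≃⋆ₐ[ℂ] A) (π : A →⋆ₙₐ[ℂ] (H →L[ℂ] H))
    (m : Multiplicative ℤ) (a : A) :
    shift H m * regRepCoeff α π a = regRepCoeff α π ((α ^ m.toAdd) a) * shift H m :=
  ContinuousLinearMap.ext fun f => lp.ext <| funext fun k => by
    change doubleRep π ((α ^ (-(k - m.toAdd))) a) (f (k - m.toAdd)) =
      doubleRep π ((α ^ (-k)) ((α ^ m.toAdd) a)) (f (k - m.toAdd))
    rw [← StarAlgEquiv.mul_apply, ← zpow_add]
    congr 4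
    ring

open CrossedProductZ

/-- `regRepCoeff`, with the coefficient algebra regarded as an algebra with `ℤ`-action. -/
def regRepCoeff' (α : A ≃⋆ₐ[ℂ] A) (π : A →⋆ₙₐ[ℂ] (H →L[ℂ] H)) :
    Coeff α →⋆ₙₐ[ℂ] (RegSpace H →L[ℂ] RegSpace H) := regRepCoeff α π

theorem shift_mul_regRepCoeff' (α : A ≃⋆ₐ[ℂ] A) (π : A →⋆ₙₐ[ℂ] (H →L[ℂ] H))
    (m : Multiplicative ℤ) (a : Coeff α) :
    shift H m * regRepCoeff' α π a = regRepCoeff' α π (m • a) * shift H m :=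
  shift_mul_regRepCoeff α π m a

/-- `π̂(∑ aₙ uⁿ) = ∑ π̂(aₙ) ûⁿ` for finite sums. -/
def regRepFinite (α : A ≃⋆ₐ[ℂ] A) (π : A →⋆ₙₐ[ℂ] (H →L[ℂ] H)) :
    FiniteSums α →+ (RegSpace H →L[ℂ] RegSpace H) :=
  SkewMonoidAlgebra.liftNC (k := Coeff α) (AddMonoidHomClass.toAddMonoidHom (regRepCoeff' α π))
    (shift H)

variable (α : A ≃⋆ₐ[ℂ] A) (π : A →⋆ₙₐ[ℂ] (H →L[ℂ] H))

theorem regRepFinite_single (n : Multiplicative ℤ) (a : Coeff α) :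
    regRepFinite α π (SkewMonoidAlgebra.single n a) = regRepCoeff' α π a * shift H n :=
  SkewMonoidAlgebra.liftNC_single ..

theorem regRepFinite_smul (c : ℂ) (f : FiniteSums α) :
    regRepFinite α π (c • f) = c • regRepFinite α π f := by
  induction f using SkewMonoidAlgebra.induction_on' with
  | add f g hf hg => rw [smul_add, map_add, map_add, smul_add, hf, hg]
  | single n a =>
    rw [SkewMonoidAlgebra.smul_single, regRepFinite_single, regRepFinite_single, ← smul_mul_assoc]
    exact congrArg (· * _) (map_smul (regRepCoeff' α π) c a)

theorem regRepFinite_mul (f g : FiniteSums α) :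
    regRepFinite α π (f * g) = regRepFinite α π f * regRepFinite α π g := by
  induction f using SkewMonoidAlgebra.induction_on' with
  | add f₁ f₂ h₁ h₂ => rw [add_mul, map_add, map_add, add_mul, h₁, h₂]
  | single m a =>
    induction g using SkewMonoidAlgebra.induction_on' with
    | add g₁ g₂ h₁ h₂ => rw [mul_add, map_add, map_add, mul_add, h₁, h₂]
    | single n b =>
      rw [SkewMonoidAlgebra.single_mul_single, regRepFinite_single, regRepFinite_single, regRepFinite_single,
        shift_mul, mul_assoc, ← mul_assoc (shift H m), shift_mul_regRepCoeff', ← mul_assoc,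
        ← mul_assoc, ← mul_assoc, ← map_mul, mul_assoc]

theorem regRepFinite_star (f : FiniteSums α) :
    regRepFinite α π (star f) = star (regRepFinite α π f) := by
  induction f using SkewMonoidAlgebra.induction_on' with
  | add f g hf hg => rw [star_add, map_add, map_add, star_add, hf, hg]
  | single n a =>
    rw [star_single, regRepFinite_single, regRepFinite_single, star_mul, star_shift, ← map_star,
      shift_mul_regRepCoeff']

theorem norm_regRepFinite_le_l1Norm (f : FiniteSums α) : ‖regRepFinite α π f‖ ≤ l1Norm α f := by
  conv_lhs => rw [← SkewMonoidAlgebra.sum_single f, SkewMonoidAlgebra.sum_def', _root_.map_sum]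
  refine (norm_sum_le _ _).trans (Finset.sum_le_sum fun n _ => ?_)
  rw [regRepFinite_single]
  refine (norm_mul_le _ _).trans ?_
  calc _ ≤ ‖regRepCoeff' α π (f.coeff n)‖ * 1 :=
        mul_le_mul_of_nonneg_left (norm_shift_le n) (norm_nonneg _)
    _ ≤ ‖f.coeff n‖ := by
        rw [mul_one]; exact NonUnitalStarAlgHom.norm_apply_le (regRepCoeff' α π) _

theorem norm_star_mul_self_clm {E : Type*} [NormedAddCommGroup E] [InnerProductSpace ℂ E]
    [CompleteSpace E] (T : E →L[ℂ] E) : ‖star T * T‖ = ‖T‖ * ‖T‖ :=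
  CStarRing.norm_star_mul_self

/-- The C⋆-seminorm `f ↦ ‖π̂(f)‖` on `C_c(ℤ, A)`. -/
def regSeminorm : Seminorm ℂ (FiniteSums α) :=
  Seminorm.of (fun f => ‖regRepFinite α π f‖)
    (fun f g => by rw [map_add]; exact norm_add_le _ _)
    (fun c f => by rw [regRepFinite_smul, norm_smul])

theorem regSeminorm_apply (f : FiniteSums α) : regSeminorm α π f = ‖regRepFinite α π f‖ := rfl

theorem isCStarSeminorm_regSeminorm : IsCStarSeminorm α (regSeminorm α π) where
  mul_le f g := by
    rw [regSeminorm_apply, regSeminorm_apply, regSeminorm_apply, regRepFinite_mul]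
    exact norm_mul_le _ _
  star_mul_self f := by
    rw [regSeminorm_apply, regSeminorm_apply, regRepFinite_mul, regRepFinite_star]
    exact norm_star_mul_self_clm _
  le_l1Norm f := norm_regRepFinite_le_l1Norm α π f

theorem norm_regRepFinite_le (f : FiniteSums α) : ‖regRepFinite α π f‖ ≤ maxNorm α f :=
  le_maxNorm α (isCStarSeminorm_regSeminorm α π) f

/-- `regRepFinite` as a map on the normed algebra `NormedFiniteSums`. -/
def regRepPre : NormedFiniteSums α →+ (RegSpace H →L[ℂ] RegSpace H) := regRepFinite α π

theorem uniformContinuous_regRepPre : UniformContinuous (regRepPre α π) :=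
  AddMonoidHomClass.uniformContinuous_of_bound (regRepPre α π) 1 fun f => by
    rw [one_mul]; exact norm_regRepFinite_le α π f

theorem extension_of (f : FiniteSums α) :
    UniformSpace.Completion.extension (regRepPre α π) (of α f) = regRepFinite α π f :=
  UniformSpace.Completion.extension_coe (uniformContinuous_regRepPre α π) f

theorem continuous_extension :
    Continuous (fun b : CrossedProductZ α =>
      UniformSpace.Completion.extension (regRepPre α π) b) :=
  UniformSpace.Completion.continuous_extension

/-- The left regular representation `π̂` of `A ⋊ ℤ` on `K`, the continuous extension of
`∑ aₙ uⁿ ↦ ∑ π̂(aₙ) ûⁿ`. -/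
def regRep : CrossedProductZ α →⋆ₙₐ[ℂ] (RegSpace H →L[ℂ] RegSpace H) where
  toFun b := UniformSpace.Completion.extension (regRepPre α π) b
  map_smul' c b := by
    have hc := continuous_extension α π
    induction b using induction_of with
    | hc => exact isClosed_eq (hc.comp (continuous_const_smul c)) (hc.const_smul c)
    | h f => rw [← of_smul, extension_of, extension_of, regRepFinite_smul]; rfl
  map_zero' := by
    have := extension_of α π 0
    rw [map_zero] at this
    exact this
  map_add' b c := by
    have hc := continuous_extension α π
    induction b, c using induction_of₂ with
    | hc => exact isClosed_eq (hc.comp continuous_add) (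
        (hc.comp continuous_fst).add (hc.comp continuous_snd))
    | h f g => rw [← of_add, extension_of, extension_of, extension_of, map_add]
  map_mul' b c := by
    have hc := continuous_extension α π
    induction b, c using induction_of₂ with
    | hc => exact isClosed_eq (hc.comp continuous_mul) (
        (hc.comp continuous_fst).mul (hc.comp continuous_snd))
    | h f g => rw [← of_mul, extension_of, extension_of, extension_of, regRepFinite_mul]
  map_star' b := by
    have hc := continuous_extension α π
    induction b using induction_of with
    | hc => exact isClosed_eq (hc.comp (continuous_star' α)) hc.star
    | h f => rw [← of_star, extension_of, extension_of, regRepFinite_star]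

theorem regRep_of (f : FiniteSums α) : regRep α π (of α f) = regRepFinite α π f :=
  extension_of α π f

/-- The regular representation `X ⋊ ℤ = (A ⋊ ℤ, K, π̂, D̂)` where `D̂` acts on the `n`-th
component of `K = ℓ²(ℤ, H ⊕ H)` as `D ⊗ σ₁ + n 1 ⊗ σ₂`. -/
def regularRepresentation (X : SpectralData A H) (α : A ≃⋆ₐ[ℂ] A) :
    SpectralData (CrossedProductZ α) (RegSpace H) where
  rep := regRep α X.rep
  dirac := LinearPMap.l2Sum (diracBlock X.dirac)

end SpectralData

end

/-!
Write `b = ∑ bₖ uᵏ`. Row `n`, column `m` of `[D̂, π̂(b)]` is `[D, c] ⊗ σ₁ + (n - m) (c ⊗ σ₂)`, where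
`c = π(α⁻ⁿ(bₙ₋ₘ))`. Row `0` shows that `bₖ` is Lipschitz with the constant of `b`, and
taking the Jordan product with `σ₂` kills the `σ₁`-term and leaves `(n - m) c`. Hence
`‖bₖ‖ ≤ 1 / |k|` on the Lipschitz ball, and removing finitely many frequencies from `b` acts on the
remaining operator as a Schur multiplier with entries `1 / (n - m)`, whose columns have uniformly
small `ℓ²`-norm. So the Fourier series converges uniformly on the Lipschitz ball, and each of its
terms ranges over a set which is totally bounded modulo scalars. This bounds the reduced norm; it is
the full norm because `ℤ` has subexponential growth. Finally, the Lipschitz ball is closed, which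
turns total boundedness into compactness.
-/

noncomputable section

open CrossedProductZ SpectralData Filter Topology

namespace CrossedProductZ

variable {A : Type*} [CStarAlgebra A] (α : A ≃⋆ₐ[ℂ] A)

/-- The coefficient `aₖ` of the finite sum `∑ aₖ uᵏ`. -/
def finCoeff (k : ℤ) : FiniteSums α →ₗ[ℂ] A where
  toFun f := f.coeff (Multiplicative.ofAdd k)
  map_add' f g := by rw [SkewMonoidAlgebra.coeff_add]; rfl
  map_smul' c f := by rw [SkewMonoidAlgebra.coeff_smul]; rfl

/-- The monomial `a uᵏ`, as a function of `a`. -/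
def monomial (k : ℤ) : A →ₗ[ℂ] FiniteSums α where
  toFun a := SkewMonoidAlgebra.single (Multiplicative.ofAdd k) (show Coeff α from a)
  map_add' _ _ := SkewMonoidAlgebra.single_add _ _ _
  map_smul' c a := (SkewMonoidAlgebra.smul_single c _ (show Coeff α from a)).symm

theorem finCoeff_monomial (k l : ℤ) (a : A) :
    finCoeff α k (monomial α l a) = if l = k then a else 0 :=
  SkewMonoidAlgebra.coeff_single_apply

variable {α} in
theorem induction_monomial {p : FiniteSums α → Prop} (f : FiniteSums α)
    (monomial : ∀ k a, p (monomial α k a)) (add : ∀ f g, p f → p g → p (f + g)) : p f := by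
  induction f using SkewMonoidAlgebra.induction_on' with
  | single n a => exact monomial n.toAdd a
  | add f g hf hg => exact add f g hf hg

theorem maxNorm_le_l1Norm (f : FiniteSums α) : maxNorm α f ≤ l1Norm α f :=
  maxNorm_le α fun _ hp => hp.le_l1Norm f

theorem of_pow (f : FiniteSums α) (n : ℕ) : of α (f ^ n) = of α f ^ n := by
  induction n with
  | zero => rw [pow_zero, pow_zero]; rfl
  | succ n ih => rw [pow_succ, of_mul, ih, pow_succ]

/-- The canonical map `CrossedProductZ.of`, as a linear map. -/
def ofLinearMap : FiniteSums α →ₗ[ℂ] CrossedProductZ α where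
  toFun := of α
  map_add' := of_add α
  map_smul' := of_smul α

/-- The map `a ↦ a uᵏ` from `A` to the crossed product. -/
def monomialCLM (k : ℤ) : A →L[ℂ] CrossedProductZ α :=
  (ofLinearMap α ∘ₗ monomial α k).mkContinuous 1 fun a => calc
    ‖of α (monomial α k a)‖ ≤ l1Norm α (monomial α k a) :=
      (norm_of α _).trans_le (maxNorm_le_l1Norm α _)
    _ = 1 * ‖a‖ := by rw [one_mul]; exact SkewMonoidAlgebra.sum_single_index norm_zero

theorem monomialCLM_apply (k : ℤ) (a : A) : monomialCLM α k a = of α (monomial α k a) := rfl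

theorem monomialCLM_zero_one : monomialCLM α 0 1 = 1 := rfl

variable {α} in
theorem mem_of_monomialCLM_mem {W : Submodule ℂ (CrossedProductZ α)}
    (hW : IsClosed (W : Set (CrossedProductZ α))) (h : ∀ k a, monomialCLM α k a ∈ W)
    (b : CrossedProductZ α) : b ∈ W := by
  induction b using induction_of with
  | hc => exact hW
  | h f =>
    induction f using induction_monomial with
    | monomial k a => exact h k a
    | add f g hf hg => exact of_add α f g ▸ W.add_mem hf hg

theorem separableSpace [TopologicalSpace.SeparableSpace A] :
    TopologicalSpace.SeparableSpace (CrossedProductZ α) := by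
  have hmon : TopologicalSpace.IsSeparable (⋃ k : ℤ, Set.range (monomialCLM α k)) :=
    .iUnion fun k => TopologicalSpace.isSeparable_range (monomialCLM α k).continuous
  rw [← TopologicalSpace.isSeparable_univ_iff]
  refine (hmon.span (R := ℂ)).closure.mono fun b _ => ?_
  refine mem_of_monomialCLM_mem (Submodule.isClosed_topologicalClosure _) (fun k a => ?_) b
  exact Submodule.le_topologicalClosure _ (Submodule.subset_span (Set.mem_iUnion_of_mem k ⟨a, rfl⟩))

/-- The Fourier coefficient `b ↦ bₖ`, the continuous extension of `finCoeff`. The definition is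
meaningful because `finCoeff` is bounded, see `SpectralData.norm_finCoeff_le`. -/
def fourierCoeff (k : ℤ) : CrossedProductZ α →L[ℂ] A :=
  (finCoeff α k).extendOfNorm (ofLinearMap α)

variable {α}

theorem exists_abs_toAdd_le (f : FiniteSums α) :
    ∃ R : ℕ, ∀ n ∈ f.support, |n.toAdd| ≤ R := by
  refine ⟨f.support.sup fun n => n.toAdd.natAbs, fun n hn => ?_⟩
  rw [Int.abs_eq_natAbs]
  exact_mod_cast Finset.le_sup (f := fun n : Multiplicative ℤ => n.toAdd.natAbs) hn

theorem abs_toAdd_le_of_mem_support_pow {f : FiniteSums α} {R : ℕ}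
    (hR : ∀ n ∈ f.support, |n.toAdd| ≤ R) (j : ℕ) :
    ∀ n ∈ (f ^ j).support, |n.toAdd| ≤ (j * R : ℕ) := by
  induction j with
  | zero =>
    intro n hn
    rw [pow_zero] at hn
    simp [Finset.mem_one.mp (SkewMonoidAlgebra.support_one_subset hn)]
  | succ j ih =>
    intro n hn
    rw [pow_succ] at hn
    obtain ⟨a, ha, b, hb, rfl⟩ := Finset.mem_mul.mp (SkewMonoidAlgebra.support_mul _ _ hn)
    calc |a.toAdd + b.toAdd| ≤ |a.toAdd| + |b.toAdd| := abs_add_le _ _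
      _ ≤ (j * R : ℕ) + R := add_le_add (ih a ha) (hR b hb)
      _ = ((j + 1) * R : ℕ) := by push_cast; ring

theorem card_support_pow_le {f : FiniteSums α} {R : ℕ}
    (hR : ∀ n ∈ f.support, |n.toAdd| ≤ R) (j : ℕ) :
    (f ^ j).support.card ≤ 2 * (j * R) + 1 := by
  have h := Finset.card_le_card_of_injOn (t := Finset.Icc (-(j * R : ℕ) : ℤ) (j * R : ℕ))
    Multiplicative.toAdd
    (fun n hn => Finset.mem_coe.mpr <| Finset.mem_Icc.mpr <|
      abs_le.mp (abs_toAdd_le_of_mem_support_pow hR j n hn))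
    Multiplicative.toAdd.injective.injOn
  rw [Int.card_Icc] at h
  omega

end CrossedProductZ

theorem le_of_frequently_pow_le_mul_pow {M r a b : ℝ} (hr : 0 ≤ r)
    (h : ∃ᶠ n : ℕ in atTop, M ^ n ≤ (a * n + b) * r ^ n) : M ≤ r := by
  by_contra! hlt
  have hM : 0 < M := hr.trans_lt hlt
  have hq : 0 ≤ r / M := div_nonneg hr hM.le
  have hq1 : r / M < 1 := (div_lt_one hM).mpr hlt
  have hlim : Tendsto (fun n : ℕ => a * (n * (r / M) ^ n) + b * (r / M) ^ n) atTop (𝓝 0) := by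
    simpa using ((tendsto_self_mul_const_pow_of_lt_one hq hq1).const_mul a).add
      ((tendsto_pow_atTop_nhds_zero_of_lt_one hq hq1).const_mul b)
  obtain ⟨n, hn, hsmall⟩ := (h.and_eventually (hlim.eventually_lt_const one_pos)).exists
  have hp : 0 < M ^ n := pow_pos hM n
  rw [show a * (n * (r / M) ^ n) + b * (r / M) ^ n = (a * n + b) * r ^ n / M ^ n by
    rw [div_pow]; ring, div_lt_one hp] at hsmall
  exact hn.not_gt hsmall

namespace SpectralData

variable {A : Type*} [CStarAlgebra A] {H : Type*} [NormedAddCommGroup H]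
  [InnerProductSpace ℂ H] [CompleteSpace H] (α : A ≃⋆ₐ[ℂ] A) (π : A →⋆ₙₐ[ℂ] (H →L[ℂ] H))

theorem doubleRep_apply (a : A) (v : WithLp 2 (H × H)) :
    doubleRep π a v = WithLp.toLp 2 (π a v.fst, π a v.snd) := rfl

theorem regRepFinite_monomial_apply (k : ℤ) (a : A) (g : RegSpace H) (n : ℤ) :
    regRepFinite α π (monomial α k a) g n = doubleRep π ((α ^ (-n)) a) (g (n - k)) := by
  change regRepFinite α π (SkewMonoidAlgebra.single _ _) g n = _
  rw [regRepFinite_single]; rfl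

theorem regRepFinite_lp_single (f : FiniteSums α) (m n : ℤ) (v : WithLp 2 (H × H)) :
    regRepFinite α π f (lp.single 2 m v) n =
      doubleRep π ((α ^ (-n)) (finCoeff α (n - m) f)) v := by
  induction f using induction_monomial with
  | monomial k a =>
    rw [regRepFinite_monomial_apply, finCoeff_monomial]
    by_cases h : k = n - m
    · rw [if_pos h, show n - k = m by omega, lp.single_apply_self]
    · rw [if_neg h, lp.single_apply_ne _ _ _ (show n - k ≠ m by omega)]
      simp only [map_zero, zero_apply]
  | add f g hf hg =>
    rw [map_add, map_add, map_add, map_add, add_apply, add_apply, lp.coeFn_add, Pi.add_apply,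
      hf, hg]

variable {π}

theorem norm_finCoeff_le (hπ : Function.Injective π) (k : ℤ) (f : FiniteSums α) :
    ‖finCoeff α k f‖ ≤ ‖regRepFinite α π f‖ := by
  rw [← NonUnitalStarAlgHom.norm_map π hπ]
  refine ContinuousLinearMap.opNorm_le_bound _ (norm_nonneg _) fun x => ?_
  have hentry : regRepFinite α π f (lp.single 2 (-k) (WithLp.toLp 2 (x, 0))) 0 =
      WithLp.toLp 2 (π (finCoeff α k f) x, 0) := by
    rw [regRepFinite_lp_single, doubleRep_apply, zero_sub, neg_neg, neg_zero, zpow_zero]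
    exact congrArg (fun y => WithLp.toLp 2 (_, y)) (map_zero _)
  calc ‖π (finCoeff α k f) x‖
      = ‖regRepFinite α π f (lp.single 2 (-k) (WithLp.toLp 2 (x, 0))) 0‖ := by
        rw [hentry, WithLp.norm_toLp_fst]
    _ ≤ ‖regRepFinite α π f (lp.single 2 (-k) (WithLp.toLp 2 (x, 0)))‖ :=
        lp.norm_apply_le_norm two_ne_zero _ 0
    _ ≤ ‖regRepFinite α π f‖ * ‖lp.single (E := fun _ : ℤ => WithLp 2 (H × H)) 2 (-k)
          (WithLp.toLp 2 (x, 0))‖ := ContinuousLinearMap.le_opNorm _ _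
    _ = ‖regRepFinite α π f‖ * ‖x‖ := by
        rw [lp.norm_single two_pos, WithLp.norm_toLp_fst]

theorem l1Norm_le_card_mul_norm_regRepFinite (hπ : Function.Injective π) (f : FiniteSums α) :
    l1Norm α f ≤ f.support.card * ‖regRepFinite α π f‖ := by
  rw [l1Norm, SkewMonoidAlgebra.sum_def', ← nsmul_eq_mul]
  exact Finset.sum_le_card_nsmul _ _ _ fun n _ => norm_finCoeff_le α hπ n.toAdd f

variable (π) in
theorem regRepFinite_pow_succ (f : FiniteSums α) (n : ℕ) :
    regRepFinite α π (f ^ (n + 1)) = regRepFinite α π f ^ (n + 1) := by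
  induction n with
  | zero => rw [zero_add, pow_one, pow_one]
  | succ n ih => rw [pow_succ, regRepFinite_mul, ih, ← pow_succ]

/-- As `ℤ` has subexponential growth, the supports of the powers of `f⋆f` grow only linearly, so
that the `ℓ¹`-norms of these powers are controlled by the reduced norm. -/
theorem maxNorm_eq_norm_regRepFinite (hπ : Function.Injective π) (f : FiniteSums α) :
    maxNorm α f = ‖regRepFinite α π f‖ := by
  refine le_antisymm ?_ (norm_regRepFinite_le α π f)
  obtain ⟨R, hR⟩ := exists_abs_toAdd_le (star f * f)
  have hsa : IsSelfAdjoint (of α (star f * f)) := by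
    rw [of_mul, of_star]; exact IsSelfAdjoint.star_mul_self _
  have hpow (j : ℕ) : maxNorm α (star f * f) ^ 2 ^ j ≤
      ((2 * R : ℝ) * (2 ^ j : ℕ) + 1) * ‖regRepFinite α π (star f * f)‖ ^ 2 ^ j := by
    have hcard : ((star f * f) ^ 2 ^ j).support.card ≤ (2 * R : ℝ) * (2 ^ j : ℕ) + 1 := by
      refine (Nat.cast_le.mpr (card_support_pow_le hR (2 ^ j))).trans_eq ?_
      push_cast; ring
    calc maxNorm α (star f * f) ^ 2 ^ j = maxNorm α ((star f * f) ^ 2 ^ j) := by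
          rw [← norm_of, ← hsa.norm_pow_two_pow, ← of_pow, norm_of]
      _ ≤ _ := (maxNorm_le_l1Norm α _).trans (l1Norm_le_card_mul_norm_regRepFinite α hπ _)
      _ ≤ _ := by
          refine mul_le_mul hcard ?_ (norm_nonneg _) (by positivity)
          obtain ⟨i, hi⟩ := Nat.exists_eq_succ_of_ne_zero (pow_ne_zero j (two_ne_zero (α := ℕ)))
          rw [hi, regRepFinite_pow_succ]
          exact norm_pow_le' _ i.succ_pos
  have hmax : maxNorm α (star f * f) ≤ ‖regRepFinite α π (star f * f)‖ :=
    le_of_frequently_pow_le_mul_pow (norm_nonneg _)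
      ((tendsto_pow_atTop_atTop_of_one_lt one_lt_two).frequently (Frequently.of_forall hpow))
  rw [maxNorm_star_mul_self, regRepFinite_mul, regRepFinite_star, norm_star_mul_self_clm] at hmax
  exact le_of_sq_le_sq (by rwa [sq, sq]) (norm_nonneg _)

theorem norm_regRep (hπ : Function.Injective π) (b : CrossedProductZ α) :
    ‖regRep α π b‖ = ‖b‖ := by
  induction b using induction_of with
  | hc => exact isClosed_eq (continuous_extension α π).norm continuous_norm
  | h f => rw [regRep_of, norm_of, maxNorm_eq_norm_regRepFinite α hπ]

theorem regRep_injective (hπ : Function.Injective π) : Function.Injective (regRep α π) :=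
  (injective_iff_map_eq_zero _).mpr fun b hb => by
    rw [← norm_eq_zero, ← norm_regRep α hπ, hb, norm_zero]

theorem fourierCoeff_of (hπ : Function.Injective π) (k : ℤ) (f : FiniteSums α) :
    fourierCoeff α k (of α f) = finCoeff α k f :=
  LinearMap.extendOfNorm_eq (e := ofLinearMap α) (denseRange_of α) ⟨1, fun f => by
    rw [one_mul]
    exact (norm_finCoeff_le α hπ k f).trans
      ((norm_regRepFinite_le α π f).trans_eq (norm_of α f).symm)⟩ f

theorem regRep_lp_single (hπ : Function.Injective π) (b : CrossedProductZ α) (m n : ℤ)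
    (v : WithLp 2 (H × H)) :
    regRep α π b (lp.single 2 m v) n =
      doubleRep π ((α ^ (-n)) (fourierCoeff α (n - m) b)) v := by
  induction b using induction_of with
  | hc =>
    have hdouble : Continuous (doubleRep π) :=
      AddMonoidHomClass.continuous_of_bound (doubleRep π) 1 fun a => by
        rw [one_mul]; exact NonUnitalStarAlgHom.norm_apply_le (doubleRep π) a
    have hα : Continuous (α ^ (-n)) := (StarAlgEquiv.isometry (α ^ (-n))).continuous
    exact isClosed_eq
      ((lp.evalCLM ℂ (fun _ : ℤ => WithLp 2 (H × H)) 2 n).continuous.comp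
        ((continuous_extension α π).clm_apply continuous_const))
      ((hdouble.comp (hα.comp (fourierCoeff α (n - m)).continuous)).clm_apply continuous_const)
  | h f => rw [regRep_of, fourierCoeff_of α hπ, regRepFinite_lp_single]

variable {α} in
theorem ext_fourierCoeff (hπ : Function.Injective π) {b c : CrossedProductZ α}
    (h : ∀ k, fourierCoeff α k b = fourierCoeff α k c) : b = c := by
  refine regRep_injective α hπ (lp.ext_continuousLinearMap ENNReal.ofNat_ne_top fun m =>
    ContinuousLinearMap.ext fun v => lp.ext (funext fun n => ?_))
  change regRep α π b (lp.single 2 m v) n = regRep α π c (lp.single 2 m v) n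
  rw [regRep_lp_single α hπ, regRep_lp_single α hπ, h]

theorem fourierCoeff_monomialCLM (hπ : Function.Injective π) (k l : ℤ) (a : A) :
    fourierCoeff α k (monomialCLM α l a) = if l = k then a else 0 := by
  rw [monomialCLM_apply, fourierCoeff_of α hπ, finCoeff_monomial]

end SpectralData

section Resolvent

variable {𝕜 E : Type*} [NontriviallyNormedField 𝕜] [NormedAddCommGroup E] [NormedSpace 𝕜 E]

/-- The linear map `D - w` on the domain of `D`. -/
def subScalar (D : E →ₗ.[𝕜] E) (w : 𝕜) : D.domain →ₗ[𝕜] E :=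
  D.toFun - w • D.domain.subtype

theorem subScalar_apply (D : E →ₗ.[𝕜] E) (w : 𝕜) (x : D.domain) :
    subScalar D w x = D x - w • (x : E) := rfl

/-- `R` is the resolvent `(D - w)⁻¹`, phrased as in `HasCompactResolvent`. -/
def IsResolvent (D : E →ₗ.[𝕜] E) (w : 𝕜) (R : E →L[𝕜] E) : Prop :=
  (∀ y, ∃ h : R y ∈ D.domain, D ⟨R y, h⟩ - w • R y = y) ∧
    ∀ x : D.domain, R (D x - w • (x : E)) = x

variable {D : E →ₗ.[𝕜] E} {w : 𝕜} {c : ℝ}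

theorem exists_isResolvent (hc : 0 < c) (hle : ∀ x : D.domain, c * ‖(x : E)‖ ≤ ‖subScalar D w x‖)
    (hrange : (subScalar D w).range = ⊤) :
    ∃ R : E →L[𝕜] E, IsResolvent D w R ∧ ‖R‖ ≤ c⁻¹ := by
  have hinj : Function.Injective (subScalar D w) :=
    (injective_iff_map_eq_zero _).mpr fun x hx => by
      have h := hle x
      rw [hx, norm_zero] at h
      exact Subtype.ext (norm_le_zero_iff.mp (nonpos_of_mul_nonpos_right h hc))
  let e := LinearEquiv.ofBijective (subScalar D w) ⟨hinj, LinearMap.range_eq_top.mp hrange⟩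
  have he (y : E) : subScalar D w (e.symm y) = y := e.apply_symm_apply y
  refine ⟨(D.domain.subtype ∘ₗ e.symm.toLinearMap).mkContinuous c⁻¹ fun y => ?_,
    ⟨fun y => ⟨(e.symm y).2, he y⟩, fun x => congrArg Subtype.val (e.symm_apply_apply x)⟩,
    LinearMap.mkContinuous_norm_le _ (inv_nonneg.mpr hc.le) _⟩
  rw [← div_eq_inv_mul, le_div_iff₀ hc, mul_comm]
  exact (hle (e.symm y)).trans_eq (congrArg _ (he y))

theorem isClosed_range_subScalar [CompleteSpace E] (hD : D.IsClosed) (hc : 0 < c)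
    (hle : ∀ x : D.domain, c * ‖(x : E)‖ ≤ ‖subScalar D w x‖) :
    IsClosed ((subScalar D w).range : Set E) := by
  have : CompleteSpace D.graph := IsClosed.completeSpace_coe (hs := hD)
  let φ : D.graph →L[𝕜] E :=
    (ContinuousLinearMap.snd 𝕜 E E - w • ContinuousLinearMap.fst 𝕜 E E) ∘L D.graph.subtypeL
  have hφ (x : D.domain) : φ ⟨(x, D x), D.mem_graph x⟩ = subScalar D w x := rfl
  have hfst (p : D.graph) : ‖p.1.1‖ ≤ c⁻¹ * ‖φ p‖ := by
    obtain ⟨x, hx⟩ := (LinearPMap.mem_graph_iff' _).mp p.2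
    rw [show p = ⟨(x, D x), D.mem_graph x⟩ from Subtype.ext hx.symm, hφ, ← div_eq_inv_mul,
      le_div_iff₀ hc, mul_comm]
    exact hle x
  have hsnd (p : D.graph) : ‖p.1.2‖ ≤ (1 + ‖w‖ * c⁻¹) * ‖φ p‖ := by
    calc ‖p.1.2‖ = ‖φ p + w • p.1.1‖ := congrArg _ (sub_add_cancel p.1.2 (w • p.1.1)).symm
      _ ≤ ‖φ p‖ + ‖w‖ * (c⁻¹ * ‖φ p‖) := norm_add_le_of_le le_rfl
          ((norm_smul_le _ _).trans (mul_le_mul_of_nonneg_left (hfst p) (norm_nonneg w)))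
      _ = _ := by ring
  have hanti : AntilipschitzWith (max c⁻¹ (1 + ‖w‖ * c⁻¹)).toNNReal φ :=
    ContinuousLinearMap.antilipschitz_of_bound φ fun p => by
      rw [Real.coe_toNNReal _ (le_max_of_le_left (inv_nonneg.mpr hc.le))]
      exact max_le
        ((hfst p).trans (mul_le_mul_of_nonneg_right (le_max_left _ _) (norm_nonneg _)))
        ((hsnd p).trans (mul_le_mul_of_nonneg_right (le_max_right _ _) (norm_nonneg _)))
  convert hanti.isClosed_range φ.uniformContinuous using 1
  ext y
  constructor
  · rintro ⟨x, rfl⟩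
    exact ⟨_, hφ x⟩
  · rintro ⟨p, rfl⟩
    obtain ⟨x, hx⟩ := (LinearPMap.mem_graph_iff' _).mp p.2
    exact ⟨x, congrArg φ (Subtype.ext hx : (⟨(x, D x), D.mem_graph x⟩ : D.graph) = p)⟩

end Resolvent

section SelfAdjoint

variable {𝕜 E : Type*} [RCLike 𝕜] [NormedAddCommGroup E] [InnerProductSpace 𝕜 E]
  [CompleteSpace E] {D : E →ₗ.[𝕜] E}

theorem isFormalAdjoint_self (hD : IsSelfAdjoint D) : D.IsFormalAdjoint D := by
  have h := LinearPMap.adjoint_isFormalAdjoint hD.dense_domain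
  rwa [LinearPMap.isSelfAdjoint_def.mp hD] at h

theorem exists_mem_domain (hD : IsSelfAdjoint D) {y w : E}
    (h : ∀ x : D.domain, inner 𝕜 w (x : E) = inner 𝕜 y (D x)) :
    ∃ hy : y ∈ D.domain, D ⟨y, hy⟩ = w := by
  have hy : y ∈ D.domain := by
    have := LinearPMap.mem_adjoint_domain_of_exists y ⟨w, h⟩
    rwa [LinearPMap.isSelfAdjoint_def.mp hD] at this
  refine ⟨hy, hD.dense_domain.eq_of_inner_left 𝕜 fun v hv => ?_⟩
  rw [h ⟨v, hv⟩]
  exact isFormalAdjoint_self hD ⟨y, hy⟩ ⟨v, hv⟩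

theorem isSelfAdjoint_of_mem_domain (hd : Dense (D.domain : Set E)) (hD : D.IsFormalAdjoint D)
    (h : ∀ y w, (∀ x : D.domain, inner 𝕜 w (x : E) = inner 𝕜 y (D x)) → y ∈ D.domain) :
    IsSelfAdjoint D := by
  have hle := hD.le_adjoint hd
  exact (LinearPMap.eq_of_le_of_domain_eq hle (le_antisymm hle.1 fun y hy =>
    h y (D.adjoint ⟨y, hy⟩) fun x => LinearPMap.adjoint_isFormalAdjoint hd ⟨y, hy⟩ x)).symm

end SelfAdjoint

section ImaginaryResolvent

variable {E : Type*} [NormedAddCommGroup E] [InnerProductSpace ℂ E] {D : E →ₗ.[ℂ] E}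

theorem norm_subScalar_sq (hD : D.IsFormalAdjoint D) (t : ℝ) (x : D.domain) :
    ‖subScalar D (t * Complex.I) x‖ ^ 2 = ‖D x‖ ^ 2 + t ^ 2 * ‖(x : E)‖ ^ 2 := by
  have him : (inner ℂ (D x) (x : E)).im = 0 := by
    rw [← Complex.conj_eq_iff_im, inner_conj_symm]
    exact (hD x x).symm
  rw [subScalar_apply, norm_sub_sq (𝕜 := ℂ), inner_smul_right, norm_smul]
  simp [him, mul_pow]

theorem abs_mul_norm_le_norm_subScalar (hD : D.IsFormalAdjoint D) (t : ℝ) (x : D.domain) :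
    |t| * ‖(x : E)‖ ≤ ‖subScalar D (t * Complex.I) x‖ := by
  refine le_of_sq_le_sq ?_ (norm_nonneg _)
  rw [norm_subScalar_sq hD, mul_pow, sq_abs]
  exact le_add_of_nonneg_left (sq_nonneg _)

variable [CompleteSpace E]

theorem range_subScalar_eq_top (hD : IsSelfAdjoint D) {t : ℝ} (ht : t ≠ 0) :
    (subScalar D (t * Complex.I)).range = ⊤ := by
  have hsymm := isFormalAdjoint_self hD
  have hclosed := isClosed_range_subScalar hD.isClosed (abs_pos.mpr ht)
    (abs_mul_norm_le_norm_subScalar hsymm t)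
  rw [← hclosed.submodule_topologicalClosure_eq, Submodule.topologicalClosure_eq_top_iff,
    Submodule.eq_bot_iff]
  intro v hv
  obtain ⟨hvD, hDv⟩ := exists_mem_domain hD (y := v) (w := ((-t : ℝ) * Complex.I) • v)
    fun x => by
      have horth := Submodule.inner_left_of_mem_orthogonal
        (LinearMap.mem_range_self (subScalar D (t * Complex.I)) x) hv
      rw [subScalar_apply, inner_sub_right, inner_smul_right, sub_eq_zero] at horth
      rw [horth, inner_smul_left]
      simp
  have hle := abs_mul_norm_le_norm_subScalar hsymm (-t) ⟨v, hvD⟩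
  rw [subScalar_apply, hDv, sub_self, norm_zero] at hle
  exact norm_le_zero_iff.mp
    (nonpos_of_mul_nonpos_right hle (abs_pos.mpr (neg_ne_zero.mpr ht)))

end ImaginaryResolvent

section CompactDirectSum

variable {ι 𝕜 : Type*} [NontriviallyNormedField 𝕜] {E F : ι → Type*}
  [∀ i, NormedAddCommGroup (E i)] [∀ i, NormedSpace 𝕜 (E i)]
  [∀ i, NormedAddCommGroup (F i)] [∀ i, NormedSpace 𝕜 (F i)]
  {p : ENNReal} [Fact (1 ≤ p)] {R : ∀ i, E i →L[𝕜] F i} {K : ℝ}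

theorem isCompactOperator_mapCLM_of_eq_zero (hK : 0 ≤ K) (hRK : ∀ i, ‖R i‖ ≤ K)
    (hR : ∀ i, IsCompactOperator (R i)) (s : Finset ι) (hs : ∀ i ∉ s, R i = 0) :
    IsCompactOperator (lp.mapCLM p R hK hRK) := by
  classical
  have hsum : lp.mapCLM p R hK hRK =
      ∑ i ∈ s, lp.singleContinuousLinearMap 𝕜 F p i ∘L R i ∘L lp.evalCLM 𝕜 E p i := by
    refine ContinuousLinearMap.ext fun f => lp.ext (funext fun i => ?_)
    rw [sum_apply, lp.coeFn_sum, Finset.sum_apply]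
    simp only [ContinuousLinearMap.comp_apply, lp.singleContinuousLinearMap_apply,
      lp.single_apply, Finset.sum_pi_single]
    change R i (f i) = if i ∈ s then R i (f i) else 0
    split_ifs with hi
    · rfl
    · rw [hs i hi, zero_apply]
  rw [hsum]
  exact Submodule.sum_mem (compactOperator (RingHom.id 𝕜) (lp E p) (lp F p)) fun i _ =>
    ((hR i).comp_clm (lp.evalCLM 𝕜 E p i)).clm_comp (lp.singleContinuousLinearMap 𝕜 F p i)

theorem isCompactOperator_mapCLM [∀ i, CompleteSpace (F i)] (hK : 0 ≤ K)
    (hRK : ∀ i, ‖R i‖ ≤ K) (hR : ∀ i, IsCompactOperator (R i))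
    (hlim : Tendsto (fun i => ‖R i‖) cofinite (𝓝 0)) :
    IsCompactOperator (lp.mapCLM p R hK hRK) := by
  classical
  let Q (s : Finset ι) (i : ι) : E i →L[𝕜] F i := if i ∈ s then R i else 0
  have hQK (s : Finset ι) (i : ι) : ‖Q s i‖ ≤ K := by
    simp only [Q]
    split_ifs
    · exact hRK i
    · rwa [norm_zero]
  refine isCompactOperator_of_tendsto (l := atTop) (F := fun s => lp.mapCLM p (Q s) hK (hQK s))
    (Metric.tendsto_nhds.mpr fun ε hε => ?_) (Eventually.of_forall fun s => ?_)
  · have hfin : {i | ¬‖R i‖ < ε / 2}.Finite := hlim.eventually_lt_const (half_pos hε)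
    filter_upwards [eventually_ge_atTop hfin.toFinset] with s hs
    have hdiff (i : ι) : ‖Q s i - R i‖ ≤ ε / 2 := by
      simp only [Q]
      split_ifs with hi
      · rw [sub_self, norm_zero]
        exact (half_pos hε).le
      · rw [zero_sub, norm_neg]
        exact le_of_lt (not_not.mp fun h => hi (hs (hfin.mem_toFinset.mpr h)))
    have hsub : lp.mapCLM p (Q s) hK (hQK s) - lp.mapCLM p R hK hRK =
        lp.mapCLM p (fun i => Q s i - R i) (half_pos hε).le hdiff := rfl
    rw [dist_eq_norm, hsub]
    exact (lp.norm_mapCLM_le p _ _ hdiff).trans_lt (half_lt_self hε)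
  · refine isCompactOperator_mapCLM_of_eq_zero hK (hQK s) (fun i => ?_) s fun i hi => if_neg hi
    simp only [Q]
    split_ifs
    · exact hR i
    · exact isCompactOperator_zero

end CompactDirectSum

section DirectSum

variable {E : Type*} [NormedAddCommGroup E] [InnerProductSpace ℂ E] {T : ℤ → E →ₗ.[ℂ] E}

theorem exists_lp_single_mem_domain_l2Sum (m : ℤ) (x : (T m).domain) :
    ∃ h : lp.single 2 m (x : E) ∈ (LinearPMap.l2Sum T).domain,
      LinearPMap.l2Sum T ⟨lp.single 2 m (x : E), h⟩ = lp.single 2 m (T m x) := by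
  have hmem (n : ℤ) : lp.single (E := fun _ : ℤ => E) 2 m (x : E) n ∈ (T n).domain := by
    rcases eq_or_ne n m with rfl | h
    · rw [lp.single_apply_self]; exact x.2
    · rw [lp.single_apply_ne _ _ _ h]; exact (T n).domain.zero_mem
  have hval (n : ℤ) : T n ⟨_, hmem n⟩ =
      lp.single (E := fun _ : ℤ => E) 2 m (T m x) n := by
    rcases eq_or_ne n m with rfl | h
    · exact (congrArg (T n) (Subtype.ext (lp.single_apply_self 2 _ _))).trans
        (lp.single_apply_self (E := fun _ : ℤ => E) 2 _ _).symm
    · exact ((congrArg (T n) (Subtype.ext (lp.single_apply_ne 2 _ _ h))).trans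
        (T n).map_zero).trans (lp.single_apply_ne (E := fun _ : ℤ => E) 2 _ _ h).symm
  refine ⟨⟨hmem, ?_⟩, lp.ext (funext hval)⟩
  rw [funext hval]
  exact lp.memℓp _

theorem isResolvent_l2Sum {w : ℂ} {R : ℤ → E →L[ℂ] E} (hR : ∀ n, IsResolvent (T n) w (R n))
    {K : ℝ} (hK : 0 ≤ K) (hRK : ∀ n, ‖R n‖ ≤ K) :
    IsResolvent (LinearPMap.l2Sum T) w (lp.mapCLM 2 R hK hRK) := by
  refine ⟨fun y => ?_, fun x => lp.ext (funext fun n => (hR n).2 ⟨x.1 n, x.2.1 n⟩)⟩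
  have hmem : lp.mapCLM 2 R hK hRK y ∈ (LinearPMap.l2Sum T).domain := by
    refine ⟨fun n => ((hR n).1 (y n)).1, ?_⟩
    convert lp.memℓp (y + w • lp.mapCLM 2 R hK hRK y) using 1
    exact funext fun n => eq_add_of_sub_eq ((hR n).1 (y n)).2
  exact ⟨hmem, lp.ext (funext fun n => ((hR n).1 (y n)).2)⟩

theorem isFormalAdjoint_l2Sum (hT : ∀ n, (T n).IsFormalAdjoint (T n)) :
    (LinearPMap.l2Sum T).IsFormalAdjoint (LinearPMap.l2Sum T) := fun f g => by
  rw [lp.inner_eq_tsum, lp.inner_eq_tsum]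
  exact tsum_congr fun n => hT n ⟨f.1 n, f.2.1 n⟩ ⟨g.1 n, g.2.1 n⟩

variable [CompleteSpace E]

theorem dense_domain_l2Sum (hT : ∀ n, Dense ((T n).domain : Set E)) :
    Dense ((LinearPMap.l2Sum T).domain : Set (lp (fun _ : ℤ => E) 2)) := by
  rw [Submodule.dense_iff_topologicalClosure_eq_top, Submodule.topologicalClosure_eq_top_iff,
    Submodule.eq_bot_iff]
  refine fun v hv => lp.ext (funext fun n => (hT n).eq_zero_of_inner_right ℂ fun x hx => ?_)
  obtain ⟨h, -⟩ := exists_lp_single_mem_domain_l2Sum (T := T) n ⟨x, hx⟩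
  exact (lp.inner_single_left n x v).symm.trans (hv _ h)

theorem isSelfAdjoint_l2Sum (hT : ∀ n, IsSelfAdjoint (T n)) :
    IsSelfAdjoint (LinearPMap.l2Sum T) := by
  refine isSelfAdjoint_of_mem_domain (dense_domain_l2Sum fun n => (hT n).dense_domain)
    (isFormalAdjoint_l2Sum fun n => isFormalAdjoint_self (hT n)) fun y w hyw => ?_
  have hentry (n : ℤ) : ∃ hy : y n ∈ (T n).domain, T n ⟨y n, hy⟩ = w n := by
    refine exists_mem_domain (hT n) fun x => ?_
    obtain ⟨h, hTx⟩ := exists_lp_single_mem_domain_l2Sum (T := T) n x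
    rw [← lp.inner_single_right, ← lp.inner_single_right, ← hTx]
    exact hyw ⟨_, h⟩
  choose hy hTy using hentry
  refine ⟨hy, ?_⟩
  rw [funext hTy]
  exact lp.memℓp w

end DirectSum

namespace SpectralData

section Pauli

theorem pair_ext {V W : Type*} {v w : WithLp 2 (V × W)} (h₁ : v.fst = w.fst)
    (h₂ : v.snd = w.snd) : v = w :=
  WithLp.ofLp_injective 2 (Prod.ext h₁ h₂)

variable {H : Type*} [NormedAddCommGroup H] [InnerProductSpace ℂ H]

variable (H) in
/-- The Pauli matrix `σ₁` acting on `H ⊗ ℂ²`. -/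
def pauliX : WithLp 2 (H × H) →L[ℂ] WithLp 2 (H × H) :=
  (WithLp.prodContinuousLinearEquiv 2 ℂ H H).symm.toContinuousLinearMap ∘L
    (WithLp.sndL 2 ℂ H H).prod (WithLp.fstL 2 ℂ H H)

variable (H) in
/-- The Pauli matrix `σ₂` acting on `H ⊗ ℂ²`. -/
def pauliY : WithLp 2 (H × H) →L[ℂ] WithLp 2 (H × H) :=
  (WithLp.prodContinuousLinearEquiv 2 ℂ H H).symm.toContinuousLinearMap ∘L
    ((-Complex.I) • WithLp.sndL 2 ℂ H H).prod (Complex.I • WithLp.fstL 2 ℂ H H)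

theorem norm_pauliX_le : ‖pauliX H‖ ≤ 1 :=
  ContinuousLinearMap.opNorm_le_bound _ zero_le_one fun v => by
    refine le_of_sq_le_sq ?_ (mul_nonneg zero_le_one (norm_nonneg v))
    rw [one_mul, WithLp.prod_norm_sq_eq_of_L2, WithLp.prod_norm_sq_eq_of_L2, add_comm]
    rfl

theorem norm_pauliY_le : ‖pauliY H‖ ≤ 1 :=
  ContinuousLinearMap.opNorm_le_bound _ zero_le_one fun v => by
    refine le_of_sq_le_sq ?_ (mul_nonneg zero_le_one (norm_nonneg v))
    rw [one_mul, WithLp.prod_norm_sq_eq_of_L2, WithLp.prod_norm_sq_eq_of_L2, add_comm]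
    change ‖Complex.I • v.fst‖ ^ 2 + ‖(-Complex.I) • v.snd‖ ^ 2 ≤ _
    rw [norm_smul, norm_smul, norm_neg, Complex.norm_I, one_mul, one_mul]

variable [CompleteSpace H]

variable (H) in
/-- The operators `S ⊗ 1` on `H ⊗ ℂ²`. -/
def tensorOne :
    (H →L[ℂ] H) →⋆ₙₐ[ℂ] (WithLp 2 (H × H) →L[ℂ] WithLp 2 (H × H)) :=
  doubleRep (NonUnitalStarAlgHom.id ℂ (H →L[ℂ] H))

theorem norm_tensorOne (S : H →L[ℂ] H) : ‖tensorOne H S‖ = ‖S‖ :=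
  NonUnitalStarAlgHom.norm_map (tensorOne H) (fun _ _ hST => ContinuousLinearMap.ext fun x =>
    congrArg (fun B : WithLp 2 (H × H) →L[ℂ] WithLp 2 (H × H) =>
      (B (WithLp.toLp 2 (x, x))).fst) hST) S

theorem isCompactOperator_tensorOne {S : H →L[ℂ] H} (hS : IsCompactOperator S) :
    IsCompactOperator (tensorOne H S) := by
  let e := (WithLp.prodContinuousLinearEquiv 2 ℂ H H).symm.toContinuousLinearMap
  have hsum : tensorOne H S =
      (e ∘L ContinuousLinearMap.inl ℂ H H) ∘L S ∘L WithLp.fstL 2 ℂ H H +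
        (e ∘L ContinuousLinearMap.inr ℂ H H) ∘L S ∘L WithLp.sndL 2 ℂ H H :=
    ContinuousLinearMap.ext fun v =>
      pair_ext (add_zero (S v.fst)).symm (zero_add (S v.snd)).symm
  rw [hsum]
  exact ((hS.comp_clm (WithLp.fstL 2 ℂ H H)).clm_comp (e ∘L ContinuousLinearMap.inl ℂ H H)).add
    ((hS.comp_clm (WithLp.sndL 2 ℂ H H)).clm_comp (e ∘L ContinuousLinearMap.inr ℂ H H))

end Pauli

section DiracBlock

variable {H : Type*} [NormedAddCommGroup H] [InnerProductSpace ℂ H] {D : H →ₗ.[ℂ] H}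

theorem diracBlock_fst (n : ℤ) (v : (diracBlock D n).domain) :
    (diracBlock D n v).fst = D ⟨v.1.snd, v.2.2⟩ - (Complex.I * n) • v.1.snd := rfl

theorem diracBlock_snd (n : ℤ) (v : (diracBlock D n).domain) :
    (diracBlock D n v).snd = D ⟨v.1.fst, v.2.1⟩ + (Complex.I * n) • v.1.fst := rfl

theorem dense_domain_diracBlock (hD : Dense (D.domain : Set H)) (n : ℤ) :
    Dense ((diracBlock D n).domain : Set (WithLp 2 (H × H))) :=
  (hD.prod hD).preimage (WithLp.prodContinuousLinearEquiv 2 ℂ H H).toHomeomorph.isOpenMap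

theorem isFormalAdjoint_diracBlock (hD : D.IsFormalAdjoint D) (n : ℤ) :
    (diracBlock D n).IsFormalAdjoint (diracBlock D n) := fun v w => by
  have h₁ : inner ℂ (D ⟨v.1.snd, v.2.2⟩) w.1.fst = inner ℂ v.1.snd (D ⟨w.1.fst, w.2.1⟩) :=
    hD ⟨v.1.snd, v.2.2⟩ ⟨w.1.fst, w.2.1⟩
  have h₂ : inner ℂ (D ⟨v.1.fst, v.2.1⟩) w.1.snd = inner ℂ v.1.fst (D ⟨w.1.snd, w.2.2⟩) :=
    hD ⟨v.1.fst, v.2.1⟩ ⟨w.1.snd, w.2.2⟩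
  change inner ℂ (diracBlock D n v).fst w.1.fst + inner ℂ (diracBlock D n v).snd w.1.snd =
    inner ℂ v.1.fst (diracBlock D n w).fst + inner ℂ v.1.snd (diracBlock D n w).snd
  rw [diracBlock_fst, diracBlock_snd, diracBlock_fst, diracBlock_snd, inner_sub_left,
    inner_add_left, inner_sub_right, inner_add_right, inner_smul_left, inner_smul_left,
    inner_smul_right, inner_smul_right, h₁, h₂, map_mul, Complex.conj_I, map_intCast]
  ring

theorem norm_diracBlock_sq (hD : D.IsFormalAdjoint D) (n : ℤ) (v : (diracBlock D n).domain) :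
    ‖diracBlock D n v‖ ^ 2 = ‖D ⟨v.1.fst, v.2.1⟩‖ ^ 2 + ‖D ⟨v.1.snd, v.2.2⟩‖ ^ 2 +
      n ^ 2 * ‖(v : WithLp 2 (H × H))‖ ^ 2 := by
  have h₁ := norm_subScalar_sq hD n ⟨v.1.snd, v.2.2⟩
  have h₂ := norm_subScalar_sq hD (-n) ⟨v.1.fst, v.2.1⟩
  simp only [subScalar_apply, Complex.ofReal_neg, neg_mul, neg_smul, sub_neg_eq_add,
    Complex.ofReal_intCast, mul_comm (n : ℂ), neg_sq] at h₁ h₂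
  rw [WithLp.prod_norm_sq_eq_of_L2, WithLp.prod_norm_sq_eq_of_L2, diracBlock_fst,
    diracBlock_snd, h₁, h₂]
  ring

theorem sqrt_mul_norm_le_norm_subScalar_diracBlock (hD : D.IsFormalAdjoint D) (n : ℤ)
    (v : (diracBlock D n).domain) : √(n ^ 2 + 1) * ‖(v : WithLp 2 (H × H))‖ ≤
      ‖subScalar (diracBlock D n) Complex.I v‖ := by
  have hsq := norm_subScalar_sq (isFormalAdjoint_diracBlock hD n) 1 v
  rw [Complex.ofReal_one, one_mul, norm_diracBlock_sq hD, one_pow, one_mul] at hsq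
  refine le_of_sq_le_sq ?_ (norm_nonneg _)
  rw [hsq, mul_pow, Real.sq_sqrt (by positivity)]
  nlinarith [sq_nonneg ‖D ⟨v.1.fst, v.2.1⟩‖, sq_nonneg ‖D ⟨v.1.snd, v.2.2⟩‖]

variable [CompleteSpace H]

theorem isSelfAdjoint_diracBlock (hD : IsSelfAdjoint D) (n : ℤ) :
    IsSelfAdjoint (diracBlock D n) := by
  refine isSelfAdjoint_of_mem_domain (dense_domain_diracBlock hD.dense_domain n)
    (isFormalAdjoint_diracBlock (isFormalAdjoint_self hD) n) fun y w h => ⟨?_, ?_⟩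
  · refine (exists_mem_domain hD (y := y.fst) (w := w.snd - (Complex.I * n) • y.fst)
      fun x => ?_).1
    have hx : inner ℂ w.fst 0 + inner ℂ w.snd (x : H) =
        inner ℂ y.fst (D x - (Complex.I * n) • (x : H)) +
          inner ℂ y.snd (D 0 + (Complex.I * n) • (0 : H)) :=
      h ⟨WithLp.toLp 2 (0, (x : H)), D.domain.zero_mem, x.2⟩
    simp only [inner_zero_right, D.map_zero, smul_zero, add_zero, zero_add] at hx
    rw [inner_sub_left, hx, inner_sub_right, inner_smul_left, inner_smul_right, map_mul,
      Complex.conj_I, map_intCast]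
    ring
  · refine (exists_mem_domain hD (y := y.snd) (w := w.fst + (Complex.I * n) • y.snd)
      fun x => ?_).1
    have hx : inner ℂ w.fst (x : H) + inner ℂ w.snd 0 =
        inner ℂ y.fst (D 0 - (Complex.I * n) • (0 : H)) +
          inner ℂ y.snd (D x + (Complex.I * n) • (x : H)) :=
      h ⟨WithLp.toLp 2 ((x : H), 0), x.2, D.domain.zero_mem⟩
    simp only [inner_zero_right, D.map_zero, smul_zero, sub_zero, add_zero, zero_add] at hx
    rw [inner_add_left, hx, inner_add_right, inner_smul_left, inner_smul_right, map_mul,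
      Complex.conj_I, map_intCast]
    ring

theorem exists_isResolvent_diracBlock (hD : IsSelfAdjoint D) (n : ℤ) :
    ∃ R, IsResolvent (diracBlock D n) Complex.I R ∧ ‖R‖ ≤ (√((n : ℝ) ^ 2 + 1))⁻¹ := by
  have hrange := range_subScalar_eq_top (isSelfAdjoint_diracBlock hD n) one_ne_zero
  rw [Complex.ofReal_one, one_mul] at hrange
  exact exists_isResolvent (Real.sqrt_pos.mpr (by positivity))
    (sqrt_mul_norm_le_norm_subScalar_diracBlock (isFormalAdjoint_self hD) n) hrange

/-- Since `σ₁ (D_n - n σ₂) = D ⊗ 1`, the resolvent of `D_n` factors through that of `D`. -/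
theorem isCompactOperator_of_isResolvent_diracBlock {z w : ℂ} {S : H →L[ℂ] H}
    (hS : ∀ x : D.domain, S (D x - z • (x : H)) = x) (hc : IsCompactOperator S) {n : ℤ}
    {R : WithLp 2 (H × H) →L[ℂ] WithLp 2 (H × H)} (hR : IsResolvent (diracBlock D n) w R) :
    IsCompactOperator R := by
  have hfactor : R = tensorOne H S ∘L
      (pauliX H ∘L (1 + w • R - (n : ℂ) • pauliY H ∘L R) - z • R) := by
    refine ContinuousLinearMap.ext fun y => ?_
    obtain ⟨hy, hDy⟩ := hR.1 y
    have h₁ : D ⟨(R y).fst, hy.1⟩ + (Complex.I * n) • (R y).fst - w • (R y).snd = y.snd :=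
      congrArg WithLp.snd hDy
    have h₂ : D ⟨(R y).snd, hy.2⟩ - (Complex.I * n) • (R y).snd - w • (R y).fst = y.fst :=
      congrArg WithLp.fst hDy
    refine pair_ext ((hS ⟨(R y).fst, hy.1⟩).symm.trans (congrArg S ?_))
      ((hS ⟨(R y).snd, hy.2⟩).symm.trans (congrArg S ?_))
    · change _ = y.snd + w • (R y).snd - (n : ℂ) • Complex.I • (R y).fst - z • (R y).fst
      rw [← h₁]
      module
    · change _ = y.fst + w • (R y).fst - (n : ℂ) • (-Complex.I) • (R y).snd - z • (R y).snd
      rw [← h₂]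
      module
  rw [hfactor]
  exact (isCompactOperator_tensorOne hc).comp_clm _

theorem hasCompactResolvent_l2Sum_diracBlock (hD : IsSelfAdjoint D) (hc : HasCompactResolvent D) :
    HasCompactResolvent (LinearPMap.l2Sum (diracBlock D)) := by
  obtain ⟨z, S, hS, -, hSD⟩ := hc
  choose R hR hle using exists_isResolvent_diracBlock hD
  have hle_one (n : ℤ) : ‖R n‖ ≤ 1 := (hle n).trans
    (inv_le_one_of_one_le₀ (Real.one_le_sqrt.mpr (le_add_of_nonneg_left (sq_nonneg _))))
  have hlim : Tendsto (fun n : ℤ => (√((n : ℝ) ^ 2 + 1))⁻¹) cofinite (𝓝 0) := by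
    rw [← cocompact_eq_cofinite]
    refine (tendsto_atTop_mono (fun n : ℤ => ?_) tendsto_norm_cocompact_atTop).inv_tendsto_atTop
    rw [Int.norm_eq_abs]
    exact Real.le_sqrt_of_sq_le (by rw [sq_abs]; exact le_add_of_nonneg_right zero_le_one)
  exact ⟨Complex.I, _, isCompactOperator_mapCLM zero_le_one hle_one
    (fun n => isCompactOperator_of_isResolvent_diracBlock hSD hS (hR n))
    (squeeze_zero (fun n => norm_nonneg _) hle hlim), isResolvent_l2Sum hR zero_le_one hle_one⟩

end DiracBlock

end SpectralData

section Commutators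

variable {E : Type*} [NormedAddCommGroup E] [InnerProductSpace ℂ E] {D : E →ₗ.[ℂ] E}

theorem isCommutator_zero : IsCommutator D 0 0 := fun _ =>
  ⟨D.domain.zero_mem, (congrArg (· - (0 : E)) D.map_zero).trans (sub_zero 0)⟩

theorem isCommutator_one : IsCommutator D 1 0 := fun x => ⟨x.2, sub_self (D x)⟩

theorem IsCommutator.add {b c S T : E →L[ℂ] E} (hb : IsCommutator D b S)
    (hc : IsCommutator D c T) : IsCommutator D (b + c) (S + T) := fun x => by
  obtain ⟨h₁, e₁⟩ := hb x
  obtain ⟨h₂, e₂⟩ := hc x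
  refine ⟨D.domain.add_mem h₁ h₂, ?_⟩
  change D (⟨b x, h₁⟩ + ⟨c x, h₂⟩) - (b (D x) + c (D x)) = S x + T x
  rw [D.map_add, ← e₁, ← e₂, add_sub_add_comm]

theorem IsCommutator.smul {b T : E →L[ℂ] E} (hb : IsCommutator D b T) (c : ℂ) :
    IsCommutator D (c • b) (c • T) := fun x => by
  obtain ⟨h, e⟩ := hb x
  refine ⟨D.domain.smul_mem c h, ?_⟩
  change D (c • ⟨b x, h⟩) - c • b (D x) = c • T x
  rw [D.map_smul, ← e, smul_sub]

theorem norm_le_of_forall_norm_inner_le {s : Set E} (hs : Dense s) {x : E} {C : ℝ}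
    (hC : 0 ≤ C) (h : ∀ y ∈ s, ‖inner ℂ x y‖ ≤ C * ‖y‖) : ‖x‖ ≤ C := by
  have hx : ‖x‖ * ‖x‖ ≤ C * ‖x‖ := by
    have h' := hs.induction (P := fun y => ‖inner ℂ x y‖ ≤ C * ‖y‖) h
      (isClosed_le (by fun_prop) (by fun_prop)) x
    rwa [inner_self_eq_norm_sq_to_K, norm_pow, RCLike.norm_ofReal, abs_norm, sq] at h'
  rcases eq_or_ne x 0 with rfl | hx₀
  · rwa [norm_zero]
  · exact le_of_mul_le_mul_right hx (norm_pos_iff.mpr hx₀)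

variable [CompleteSpace E]

theorem mem_domain_of_norm_inner_le (hD : IsSelfAdjoint D) {y : E} {C : ℝ}
    (h : ∀ x : D.domain, ‖inner ℂ y (D x)‖ ≤ C * ‖(x : E)‖) : y ∈ D.domain := by
  have hmem : y ∈ D.adjoint.domain := by
    rw [LinearPMap.mem_adjoint_domain_iff]
    exact (((innerₛₗ ℂ y).comp D.toFun).mkContinuous C h).continuous
  rwa [LinearPMap.isSelfAdjoint_def.mp hD] at hmem

theorem exists_isCommutator_of_norm_le (hD : Dense (D.domain : Set E)) {b : E →L[ℂ] E} {C : ℝ}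
    (hC : 0 ≤ C) (hb : ∀ x : D.domain, ∃ h : b x ∈ D.domain,
      ‖D ⟨b x, h⟩ - b (D x)‖ ≤ C * ‖(x : E)‖) : ∃ T, IsCommutator D b T ∧ ‖T‖ ≤ C := by
  choose hmem hle using hb
  let T : D.domain →ₗ[ℂ] E :=
    D.toFun ∘ₗ (b.toLinearMap ∘ₗ D.domain.subtype).codRestrict D.domain hmem -
      b.toLinearMap ∘ₗ D.toFun
  exact ⟨T.extendOfNorm D.domain.subtype,
    fun x => ⟨hmem x, (LinearMap.extendOfNorm_eq (f := T) (e := D.domain.subtype)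
      hD.denseRange_val ⟨C, hle⟩ x).symm⟩,
    LinearMap.opNorm_extendOfNorm_le hD.denseRange_val hC hle⟩

/-- The right-hand side is a closed condition on `b` in the weak operator topology. -/
theorem exists_isCommutator_norm_le_iff (hD : IsSelfAdjoint D) {C : ℝ} (hC : 0 ≤ C)
    (b : E →L[ℂ] E) : (∃ T, IsCommutator D b T ∧ ‖T‖ ≤ C) ↔ ∀ x y : D.domain,
      ‖inner ℂ (b x) (D y) - inner ℂ (b (D x)) (y : E)‖ ≤ C * ‖(x : E)‖ * ‖(y : E)‖ := by
  have hinner (x y : D.domain) (h : b x ∈ D.domain) :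
      inner ℂ (b x) (D y) - inner ℂ (b (D x)) (y : E) =
        inner ℂ (D ⟨b x, h⟩ - b (D x)) (y : E) := by
    rw [inner_sub_left, isFormalAdjoint_self hD ⟨b x, h⟩ y]
  constructor
  · rintro ⟨T, hT, hle⟩ x y
    obtain ⟨h, e⟩ := hT x
    rw [hinner x y h, e]
    exact (norm_inner_le_norm _ _).trans
      (mul_le_mul_of_nonneg_right (T.le_of_opNorm_le hle x) (norm_nonneg _))
  · refine fun h => exists_isCommutator_of_norm_le hD.dense_domain hC fun x => ?_
    have hx : b x ∈ D.domain :=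
      mem_domain_of_norm_inner_le hD (C := C * ‖(x : E)‖ + ‖b (D x)‖) fun y => by
        rw [← sub_add_cancel (inner ℂ (b x) (D y)) (inner ℂ (b (D x)) (y : E)), add_mul]
        exact norm_add_le_of_le (h x y) (norm_inner_le_norm _ _)
    exact ⟨hx, norm_le_of_forall_norm_inner_le hD.dense_domain
      (mul_nonneg hC (norm_nonneg _)) fun y hy =>
        (congrArg norm (hinner x ⟨y, hy⟩ hx)).symm.trans_le (h x ⟨y, hy⟩)⟩

end Commutators

namespace SpectralData

variable {A : Type*} [CStarAlgebra A] {H : Type*} [NormedAddCommGroup H]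
  [InnerProductSpace ℂ H] [CompleteSpace H] (X : SpectralData A H)

theorem continuous_rep : Continuous X.rep :=
  AddMonoidHomClass.continuous_of_bound X.rep 1 fun a => by
    rw [one_mul]
    exact NonUnitalStarAlgHom.norm_apply_le X.rep a

theorem rep_one (hX : (Submodule.span ℂ {y : H | ∃ a x, X.rep a x = y}).topologicalClosure = ⊤) :
    X.rep 1 = 1 := by
  have hle : (Submodule.span ℂ {y : H | ∃ a x, X.rep a x = y}).topologicalClosure ≤
      LinearMap.eqLocus (X.rep 1 : H →ₗ[ℂ] H) LinearMap.id := by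
    refine Submodule.topologicalClosure_minimal _ (Submodule.span_le.mpr ?_)
      (isClosed_eq (X.rep 1).continuous continuous_id)
    rintro _ ⟨a, x, rfl⟩
    change X.rep 1 (X.rep a x) = X.rep a x
    rw [← mul_apply_eq_comp, ← map_mul, one_mul]
  exact ContinuousLinearMap.ext fun y => hle (hX ▸ Submodule.mem_top)

/-- `C¹(X)` as a linear subspace. -/
def C1Submodule : Submodule ℂ A where
  carrier := X.C1
  zero_mem' := ⟨0, (map_zero X.rep).symm ▸ isCommutator_zero⟩
  add_mem' := by
    rintro a b ⟨S, hS⟩ ⟨T, hT⟩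
    exact ⟨S + T, (map_add X.rep a b).symm ▸ hS.add hT⟩
  smul_mem' := by
    rintro c a ⟨T, hT⟩
    exact ⟨c • T, (map_smul X.rep c a).symm ▸ hT.smul c⟩

theorem isClosed_lipBall (hD : IsSelfAdjoint X.dirac) : IsClosed X.lipBall := by
  have h : X.lipBall = ⋂ (x : X.dirac.domain) (y : X.dirac.domain),
      {a | ‖inner ℂ (X.rep a x) (X.dirac y) - inner ℂ (X.rep a (X.dirac x)) (y : H)‖ ≤
        1 * ‖(x : H)‖ * ‖(y : H)‖} := by
    ext a
    simp only [Set.mem_iInter]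
    exact exists_isCommutator_norm_le_iff hD zero_le_one (X.rep a)
  rw [h]
  have := X.continuous_rep
  exact isClosed_iInter fun x => isClosed_iInter fun y =>
    isClosed_le (by fun_prop) continuous_const

theorem add_mem_lipBall {a b : A} (ha : a ∈ X.lipBall) (hb : b ∈ X.commutant) :
    a + b ∈ X.lipBall := by
  obtain ⟨T, hT, hle⟩ := ha
  refine ⟨T, ?_, hle⟩
  rw [map_add, ← add_zero T]
  exact hT.add hb

theorem mkQ_preimage_image_lipBall :
    X.commutant.mkQ ⁻¹' (X.commutant.mkQ '' X.lipBall) = X.lipBall := by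
  refine subset_antisymm ?_ (Set.subset_preimage_image _ _)
  rintro a ⟨b, hb, hab⟩
  have h := X.add_mem_lipBall hb ((Submodule.Quotient.eq _).mp hab.symm)
  rwa [add_sub_cancel] at h

theorem isClosed_image_lipBall (hD : IsSelfAdjoint X.dirac) :
    IsClosed (X.commutant.mkQ '' X.lipBall) := by
  rw [← X.commutant.isOpenQuotientMap_mkQ.isQuotientMap.isClosed_preimage,
    X.mkQ_preimage_image_lipBall]
  exact X.isClosed_lipBall hD

end SpectralData

section JordanProduct

variable {R : Type*} [NormedRing R] [NormedAlgebra ℂ R]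

/-- The Jordan product `(ab + ba) / 2`. -/
def jordanMul (a b : R) : R := (2⁻¹ : ℂ) • (a * b + b * a)

theorem norm_jordanMul_le {a : R} (ha : ‖a‖ ≤ 1) (b : R) : ‖jordanMul a b‖ ≤ ‖b‖ := by
  have hab : ‖a * b‖ ≤ ‖b‖ :=
    (norm_mul_le a b).trans (mul_le_of_le_one_left (norm_nonneg b) ha)
  have hba : ‖b * a‖ ≤ ‖b‖ :=
    (norm_mul_le b a).trans (mul_le_of_le_one_right (norm_nonneg b) ha)
  have h2 : ‖(2⁻¹ : ℂ)‖ = 2⁻¹ := by rw [norm_inv, Complex.norm_two]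
  rw [jordanMul, norm_smul, h2]
  linarith [norm_add_le_of_le hab hba]

end JordanProduct

section MatrixEntry

open scoped ENNReal

variable {ι E : Type*} [NormedAddCommGroup E] [NormedSpace ℂ E] {p : ℝ≥0∞} [Fact (1 ≤ p)]

/-- The diagonal operator on `ℓᵖ(ι, E)` all of whose diagonal entries are `σ`. -/
def ampliation (σ : E →L[ℂ] E) : lp (fun _ : ι => E) p →L[ℂ] lp (fun _ : ι => E) p :=
  lp.mapCLM p (fun _ => σ) (norm_nonneg σ) fun _ => le_rfl

theorem norm_ampliation_le (σ : E →L[ℂ] E) :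
    ‖(ampliation σ : lp (fun _ : ι => E) p →L[ℂ] lp (fun _ : ι => E) p)‖ ≤ ‖σ‖ :=
  lp.norm_mapCLM_le _ _ _ _

variable [DecidableEq ι]

/-- The entry in row `n` and column `m` of an operator on `ℓᵖ(ι, E)`. -/
def matrixEntry (S : lp (fun _ : ι => E) p →L[ℂ] lp (fun _ : ι => E) p) (n m : ι) : E →L[ℂ] E :=
  lp.evalCLM ℂ (fun _ : ι => E) p n ∘L S ∘L lp.singleContinuousLinearMap ℂ (fun _ : ι => E) p m

theorem norm_matrixEntry_le (S : lp (fun _ : ι => E) p →L[ℂ] lp (fun _ : ι => E) p) (n m : ι) :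
    ‖matrixEntry S n m‖ ≤ ‖S‖ := by
  have hp : 0 < p := zero_lt_one.trans_le Fact.out
  refine ContinuousLinearMap.opNorm_le_bound _ (norm_nonneg S) fun v => ?_
  calc ‖S (lp.single p m v) n‖ ≤ ‖S (lp.single p m v)‖ := lp.norm_apply_le_norm hp.ne' _ _
    _ ≤ ‖S‖ * ‖lp.single (E := fun _ : ι => E) p m v‖ := S.le_opNorm _
    _ = ‖S‖ * ‖v‖ := by rw [lp.norm_single hp]

theorem matrixEntry_jordanMul_ampliation (σ : E →L[ℂ] E)
    (S : lp (fun _ : ι => E) p →L[ℂ] lp (fun _ : ι => E) p) (n m : ι) :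
    matrixEntry (jordanMul (ampliation σ) S) n m = jordanMul σ (matrixEntry S n m) := by
  refine ContinuousLinearMap.ext fun v => ?_
  have hsingle : ampliation σ (lp.single p m v) = lp.single (E := fun _ : ι => E) p m (σ v) :=
    lp.ext (funext fun n => (Pi.apply_single (fun _ => σ) (fun _ => map_zero σ) m v n))
  change (2⁻¹ : ℂ) • (σ (S (lp.single p m v) n) + S (ampliation σ (lp.single p m v)) n) = _
  rw [hsingle]
  rfl

end MatrixEntry

section GeneralizedCommutator

variable {E : Type*} [NormedAddCommGroup E] [InnerProductSpace ℂ E]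

/-- `W` is the generalized commutator `T b - b S`: the operator `b` maps the domain of `S` into
that of `T`, and `W` agrees with `T b - b S` there. -/
def IsGeneralizedCommutator (T S : E →ₗ.[ℂ] E) (b W : E →L[ℂ] E) : Prop :=
  ∀ x : S.domain, ∃ h : b x ∈ T.domain, T ⟨b x, h⟩ - b (S x) = W x

theorem IsCommutator.matrixEntry {T : ℤ → E →ₗ.[ℂ] E}
    {B C : lp (fun _ : ℤ => E) 2 →L[ℂ] lp (fun _ : ℤ => E) 2}
    (hC : IsCommutator (LinearPMap.l2Sum T) B C) (n m : ℤ) :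
    IsGeneralizedCommutator (T n) (T m) (matrixEntry B n m) (matrixEntry C n m) := fun x => by
  obtain ⟨hx, hTx⟩ := exists_lp_single_mem_domain_l2Sum (T := T) m x
  obtain ⟨h, hcomm⟩ := hC ⟨_, hx⟩
  rw [hTx] at hcomm
  exact ⟨h.1 n, congrArg (fun f : lp (fun _ : ℤ => E) 2 => f n) hcomm⟩

theorem IsGeneralizedCommutator.unique {S T : E →ₗ.[ℂ] E} {b W W' : E →L[ℂ] E}
    (hS : Dense (S.domain : Set E)) (hW : IsGeneralizedCommutator T S b W)
    (hW' : IsGeneralizedCommutator T S b W') : W = W' :=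
  ContinuousLinearMap.ext_on (hS.mono Submodule.subset_span) fun x hx =>
    (hW ⟨x, hx⟩).choose_spec.symm.trans (hW' ⟨x, hx⟩).choose_spec

end GeneralizedCommutator

namespace SpectralData

section DiracCommutator

theorem norm_jordanMul_ampliation_pauliY_le {H : Type*} [NormedAddCommGroup H]
    [InnerProductSpace ℂ H] (T : RegSpace H →L[ℂ] RegSpace H) :
    ‖jordanMul (ampliation (pauliY H)) T‖ ≤ ‖T‖ := by
  have hY : ‖(ampliation (pauliY H) : RegSpace H →L[ℂ] RegSpace H)‖ ≤ 1 :=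
    (norm_ampliation_le _).trans norm_pauliY_le
  exact norm_jordanMul_le hY T

variable {H : Type*} [NormedAddCommGroup H] [InnerProductSpace ℂ H] [CompleteSpace H]
  {D : H →ₗ.[ℂ] H} {c T : H →L[ℂ] H} {W : WithLp 2 (H × H) →L[ℂ] WithLp 2 (H × H)} {n m : ℤ}

theorem isGeneralizedCommutator_diracBlock (hT : IsCommutator D c T) (n m : ℤ) :
    IsGeneralizedCommutator (diracBlock D n) (diracBlock D m) (tensorOne H c)
      (pauliX H * tensorOne H T + ((n - m : ℤ) : ℂ) • (pauliY H * tensorOne H c)) := fun v => by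
  obtain ⟨h₁, e₁⟩ := hT ⟨v.1.fst, v.2.1⟩
  obtain ⟨h₂, e₂⟩ := hT ⟨v.1.snd, v.2.2⟩
  refine ⟨⟨h₁, h₂⟩, pair_ext ?_ ?_⟩
  · change D ⟨c v.1.snd, h₂⟩ - (Complex.I * n) • c v.1.snd -
      c (D ⟨v.1.snd, v.2.2⟩ - (Complex.I * m) • v.1.snd) =
        T v.1.snd + ((n - m : ℤ) : ℂ) • -Complex.I • c v.1.snd
    rw [← e₂, map_sub, map_smul, Int.cast_sub]
    module
  · change D ⟨c v.1.fst, h₁⟩ + (Complex.I * n) • c v.1.fst -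
      c (D ⟨v.1.fst, v.2.1⟩ + (Complex.I * m) • v.1.fst) =
        T v.1.fst + ((n - m : ℤ) : ℂ) • Complex.I • c v.1.fst
    rw [← e₁, map_add, map_smul, Int.cast_sub]
    module

theorem exists_isCommutator_of_diracBlock (hD : Dense (D.domain : Set H))
    (hW : IsGeneralizedCommutator (diracBlock D n) (diracBlock D m) (tensorOne H c) W) :
    ∃ T, IsCommutator D c T ∧ ‖T‖ ≤ ‖W‖ := by
  refine exists_isCommutator_of_norm_le hD (norm_nonneg W) fun x => ?_
  obtain ⟨h₁, e₁⟩ := hW ⟨WithLp.toLp 2 ((x : H), 0), x.2, D.domain.zero_mem⟩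
  obtain ⟨h₂, e₂⟩ := hW ⟨WithLp.toLp 2 (0, (x : H)), D.domain.zero_mem, x.2⟩
  have hsnd : D ⟨c x, h₁.1⟩ + (Complex.I * n) • c x - c (D x + (Complex.I * m) • (x : H)) =
      (W (WithLp.toLp 2 ((x : H), 0))).snd := congrArg WithLp.snd e₁
  have hfst : D ⟨c x, h₁.1⟩ - (Complex.I * n) • c x - c (D x - (Complex.I * m) • (x : H)) =
      (W (WithLp.toLp 2 (0, (x : H)))).fst := congrArg WithLp.fst e₂
  have hle₁ : ‖(W (WithLp.toLp 2 ((x : H), 0))).snd‖ ≤ ‖W‖ * ‖(x : H)‖ :=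
    (WithLp.norm_snd_le H _).trans ((W.le_opNorm _).trans_eq (by rw [WithLp.norm_toLp_fst]))
  have hle₂ : ‖(W (WithLp.toLp 2 (0, (x : H)))).fst‖ ≤ ‖W‖ * ‖(x : H)‖ :=
    (WithLp.norm_fst_le H _).trans ((W.le_opNorm _).trans_eq (by rw [WithLp.norm_toLp_snd]))
  have hsum : (2 : ℝ) • (D ⟨c x, h₁.1⟩ - c (D x)) =
      (W (WithLp.toLp 2 ((x : H), 0))).snd + (W (WithLp.toLp 2 (0, (x : H)))).fst := by
    rw [← hsnd, ← hfst, map_add, map_sub, map_smul]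
    module
  refine ⟨h₁.1, ?_⟩
  have hnorm := norm_add_le_of_le hle₁ hle₂
  rw [← hsum, norm_smul, Real.norm_two] at hnorm
  linarith

theorem jordanMul_pauliY (T c : H →L[ℂ] H) (k : ℂ) :
    jordanMul (pauliY H) (pauliX H * tensorOne H T + k • (pauliY H * tensorOne H c)) =
      k • tensorOne H c := by
  refine ContinuousLinearMap.ext fun v => pair_ext ?_ ?_
  · change (2⁻¹ : ℂ) • (-Complex.I • (T v.fst + k • Complex.I • c v.fst) +
      (T (Complex.I • v.fst) + k • -Complex.I • c (Complex.I • v.fst))) = k • c v.fst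
    rw [map_smul, map_smul]
    linear_combination (norm := module) (-k * Complex.I_mul_I) • c v.fst
  · change (2⁻¹ : ℂ) • (Complex.I • (T v.snd + k • -Complex.I • c v.snd) +
      (T (-Complex.I • v.snd) + k • Complex.I • c (-Complex.I • v.snd))) = k • c v.snd
    rw [map_smul, map_smul]
    linear_combination (norm := module) (-k * Complex.I_mul_I) • c v.snd

theorem jordanMul_pauliY_of_diracBlock (hD : Dense (D.domain : Set H))
    (hW : IsGeneralizedCommutator (diracBlock D n) (diracBlock D m) (tensorOne H c) W) :
    jordanMul (pauliY H) W = ((n - m : ℤ) : ℂ) • tensorOne H c := by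
  obtain ⟨T, hT, -⟩ := exists_isCommutator_of_diracBlock hD hW
  rw [hW.unique (dense_domain_diracBlock hD m) (isGeneralizedCommutator_diracBlock hT n m),
    jordanMul_pauliY]

end DiracCommutator

section RegularRepresentation

variable {A : Type*} [CStarAlgebra A] {H : Type*} [NormedAddCommGroup H]
  [InnerProductSpace ℂ H] [CompleteSpace H] (α : A ≃⋆ₐ[ℂ] A)

theorem matrixEntry_regRep {π : A →⋆ₙₐ[ℂ] (H →L[ℂ] H)} (hπ : Function.Injective π)
    (b : CrossedProductZ α) (n m : ℤ) : matrixEntry (regRep α π b) n m =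
      tensorOne H (π ((α ^ (-n)) (fourierCoeff α (n - m) b))) :=
  ContinuousLinearMap.ext (regRep_lp_single α hπ b m n)

variable {α} {X : SpectralData A H} {b : CrossedProductZ α}
  {T : RegSpace H →L[ℂ] RegSpace H}

theorem isGeneralizedCommutator_matrixEntry (hπ : Function.Injective X.rep)
    (hT : IsCommutator (X.regularRepresentation α).dirac ((X.regularRepresentation α).rep b) T)
    (n m : ℤ) : IsGeneralizedCommutator (diracBlock X.dirac n) (diracBlock X.dirac m)
      (tensorOne H (X.rep ((α ^ (-n)) (fourierCoeff α (n - m) b)))) (matrixEntry T n m) := by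
  rw [← matrixEntry_regRep α hπ]
  exact hT.matrixEntry n m

theorem exists_isCommutator_fourierCoeff (hπ : Function.Injective X.rep)
    (hD : Dense (X.dirac.domain : Set H))
    (hT : IsCommutator (X.regularRepresentation α).dirac ((X.regularRepresentation α).rep b) T)
    (k : ℤ) : ∃ S, IsCommutator X.dirac (X.rep (fourierCoeff α k b)) S ∧ ‖S‖ ≤ ‖T‖ := by
  have h := isGeneralizedCommutator_matrixEntry hπ hT 0 (-k)
  rw [neg_zero, zpow_zero, sub_neg_eq_add, zero_add] at h
  obtain ⟨S, hS, hle⟩ := exists_isCommutator_of_diracBlock hD h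
  exact ⟨S, hS, hle.trans (norm_matrixEntry_le T 0 (-k))⟩

theorem matrixEntry_jordanMul_pauliY (hπ : Function.Injective X.rep)
    (hD : Dense (X.dirac.domain : Set H))
    (hT : IsCommutator (X.regularRepresentation α).dirac ((X.regularRepresentation α).rep b) T)
    (n m : ℤ) : matrixEntry (jordanMul (ampliation (pauliY H)) T) n m =
      ((n - m : ℤ) : ℂ) • matrixEntry ((X.regularRepresentation α).rep b) n m := by
  rw [matrixEntry_jordanMul_ampliation, jordanMul_pauliY_of_diracBlock hD
    (isGeneralizedCommutator_matrixEntry hπ hT n m)]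
  exact congrArg _ (matrixEntry_regRep α hπ b n m).symm

theorem abs_mul_norm_fourierCoeff_le (hπ : Function.Injective X.rep)
    (hD : Dense (X.dirac.domain : Set H))
    (hT : IsCommutator (X.regularRepresentation α).dirac ((X.regularRepresentation α).rep b) T)
    (k : ℤ) : |(k : ℝ)| * ‖fourierCoeff α k b‖ ≤ ‖T‖ := by
  have h := norm_matrixEntry_le (jordanMul (ampliation (pauliY H)) T) 0 (-k)
  rw [matrixEntry_jordanMul_pauliY hπ hD hT] at h
  have hentry : matrixEntry ((X.regularRepresentation α).rep b) 0 (-k) = _ :=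
    matrixEntry_regRep α hπ b 0 (-k)
  rw [hentry, neg_zero, zpow_zero, sub_neg_eq_add, zero_add, norm_smul, norm_tensorOne,
    Complex.norm_intCast] at h
  exact (congrArg _ (NonUnitalStarAlgHom.norm_map X.rep hπ _).symm).trans_le
    (h.trans (norm_jordanMul_ampliation_pauliY_le T))

end RegularRepresentation

end SpectralData

section SchurMultiplier

theorem hasSum_norm_sq_lp {ι : Type*} {E : ι → Type*} [∀ i, NormedAddCommGroup (E i)]
    (f : lp E 2) : HasSum (fun i => ‖f i‖ ^ 2) (‖f‖ ^ 2) := by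
  have h := lp.hasSum_norm (p := 2) (by norm_num) f
  simpa only [ENNReal.toReal_ofNat, Real.rpow_ofNat] using h

variable {ι E : Type*} [DecidableEq ι] [NormedAddCommGroup E] [NormedSpace ℂ E]
  {c : ι → ι → ℂ} {γ : ℝ} {S V : lp (fun _ : ι => E) 2 →L[ℂ] lp (fun _ : ι => E) 2}

theorem apply_eq_of_matrixEntry_eq_smul
    (hV : ∀ n m, matrixEntry V n m = c n m • matrixEntry S n m) {n : ι}
    {G : lp (fun _ : ι => E) 2 →L[ℂ] lp (fun _ : ι => E) 2}
    (hG : ∀ f m, G f m = c n m • f m) (f : lp (fun _ : ι => E) 2) : V f n = S (G f) n := by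
  have hrow : lp.evalCLM ℂ (fun _ : ι => E) 2 n ∘L V =
      lp.evalCLM ℂ (fun _ : ι => E) 2 n ∘L S ∘L G := by
    refine lp.ext_continuousLinearMap ENNReal.ofNat_ne_top fun m => ContinuousLinearMap.ext
      fun v => ?_
    have hsingle : G (lp.single 2 m v) = c n m • lp.single (E := fun _ : ι => E) 2 m v := by
      refine lp.ext (funext fun k => (hG _ k).trans ?_)
      change _ = c n m • lp.single (E := fun _ : ι => E) 2 m v k
      obtain rfl | hk := eq_or_ne k m
      · rfl
      · rw [lp.single_apply_ne _ _ _ hk, smul_zero, smul_zero]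
    change matrixEntry V n m v = S (G (lp.single 2 m v)) n
    rw [hV, hsingle, map_smul]
    rfl
  exact DFunLike.congr_fun hrow f

theorem norm_apply_le_of_matrixEntry_eq_smul (hcγ : ∀ n m, ‖c n m‖ ≤ γ)
    (hV : ∀ n m, matrixEntry V n m = c n m • matrixEntry S n m) (f : lp (fun _ : ι => E) 2)
    (n : ι) : Summable (fun m => ‖c n m‖ ^ 2 * ‖f m‖ ^ 2) ∧
      ‖V f n‖ ^ 2 ≤ ‖S‖ ^ 2 * ∑' m, ‖c n m‖ ^ 2 * ‖f m‖ ^ 2 := by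
  have hbound (m : ι) : ‖c n m • ContinuousLinearMap.id ℂ E‖ ≤ γ := by
    rw [norm_smul]
    exact (mul_le_of_le_one_right (norm_nonneg _) ContinuousLinearMap.norm_id_le).trans (hcγ n m)
  let G : lp (fun _ : ι => E) 2 →L[ℂ] lp (fun _ : ι => E) 2 :=
    lp.mapCLM 2 (fun m => c n m • ContinuousLinearMap.id ℂ E)
      ((norm_nonneg _).trans (hcγ n n)) hbound
  have hsum : HasSum (fun m => ‖c n m‖ ^ 2 * ‖f m‖ ^ 2) (‖G f‖ ^ 2) := by
    convert hasSum_norm_sq_lp (G f) using 2 with m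
    change _ = ‖c n m • f m‖ ^ 2
    rw [norm_smul, mul_pow]
  refine ⟨hsum.summable, ?_⟩
  rw [hsum.tsum_eq, apply_eq_of_matrixEntry_eq_smul hV (G := G) (fun _ _ => rfl), ← mul_pow]
  exact pow_le_pow_left₀ (norm_nonneg _)
    ((lp.norm_apply_le_norm two_ne_zero _ _).trans (S.le_opNorm _)) 2

theorem norm_le_of_matrixEntry_eq_smul (hγ : 0 ≤ γ)
    (hc : ∀ (m : ι) (s : Finset ι), ∑ n ∈ s, ‖c n m‖ ^ 2 ≤ γ ^ 2)
    (hV : ∀ n m, matrixEntry V n m = c n m • matrixEntry S n m) : ‖V‖ ≤ γ * ‖S‖ := by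
  have hcγ (n m : ι) : ‖c n m‖ ≤ γ :=
    le_of_sq_le_sq ((Finset.sum_singleton _ _).symm.trans_le (hc m {n})) hγ
  have hSγ : 0 ≤ γ * ‖S‖ := mul_nonneg hγ (norm_nonneg S)
  refine ContinuousLinearMap.opNorm_le_bound _ hSγ fun f => ?_
  choose hsum hrow using norm_apply_le_of_matrixEntry_eq_smul hcγ hV f
  refine lp.norm_le_of_forall_sum_le (by norm_num) (mul_nonneg hSγ (norm_nonneg f)) fun s => ?_
  simp only [ENNReal.toReal_ofNat, Real.rpow_ofNat]
  calc ∑ n ∈ s, ‖V f n‖ ^ 2 ≤ ∑ n ∈ s, ‖S‖ ^ 2 * ∑' m, ‖c n m‖ ^ 2 * ‖f m‖ ^ 2 :=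
        Finset.sum_le_sum fun n _ => hrow n
    _ = ‖S‖ ^ 2 * ∑' m, (∑ n ∈ s, ‖c n m‖ ^ 2) * ‖f m‖ ^ 2 := by
        simp only [← Finset.mul_sum, ← Summable.tsum_finsetSum fun n _ => hsum n, Finset.sum_mul]
    _ ≤ ‖S‖ ^ 2 * ∑' m, γ ^ 2 * ‖f m‖ ^ 2 := by
        refine mul_le_mul_of_nonneg_left (Summable.tsum_le_tsum
          (fun m => mul_le_mul_of_nonneg_right (hc m s) (sq_nonneg _)) ?_
          ((hasSum_norm_sq_lp f).summable.mul_left _)) (sq_nonneg _)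
        simp only [Finset.sum_mul]
        exact summable_sum fun n _ => hsum n
    _ = (γ * ‖S‖ * ‖f‖) ^ 2 := by
        rw [tsum_mul_left, (hasSum_norm_sq_lp f).tsum_eq]
        ring

end SchurMultiplier

theorem exists_finset_forall_sum_sdiff_le {ι : Type*} [DecidableEq ι] {f : ι → ℝ}
    (hf : Summable f) (s₀ : Finset ι) {ε : ℝ} (hε : 0 < ε) :
    ∃ s, s₀ ⊆ s ∧ ∀ t, ∑ i ∈ t \ s, f i ≤ ε := by
  obtain ⟨s, hs⟩ := summable_iff_vanishing_norm.mp hf ε hε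
  exact ⟨s₀ ∪ s, Finset.subset_union_left, fun t => (le_abs_self _).trans (hs _
    (Finset.disjoint_left.mpr fun _ hi hi' =>
      (Finset.mem_sdiff.mp hi).2 (Finset.mem_union_right _ hi'))).le⟩

namespace SpectralData

section Fourier

variable {A : Type*} [CStarAlgebra A] {H : Type*} [NormedAddCommGroup H]
  [InnerProductSpace ℂ H] [CompleteSpace H] {α : A ≃⋆ₐ[ℂ] A}

theorem fourierCoeff_sub_sum_monomialCLM {π : A →⋆ₙₐ[ℂ] (H →L[ℂ] H)} (hπ : Function.Injective π)
    (b : CrossedProductZ α) (s : Finset ℤ) (j : ℤ) :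
    fourierCoeff α j (b - ∑ k ∈ s, monomialCLM α k (fourierCoeff α k b)) =
      if j ∈ s then 0 else fourierCoeff α j b := by
  simp only [map_sub, map_sum, fourierCoeff_monomialCLM α hπ, Finset.sum_ite_eq']
  split_ifs
  · exact sub_self _
  · exact sub_zero _

variable {X : SpectralData A H} {b : CrossedProductZ α} {T : RegSpace H →L[ℂ] RegSpace H}

/-- Up to the contraction `jordanMul σ₂`, removing the frequencies in `s` from `b` multiplies the
matrix entries of the commutator `T` by `1 / (n - m)` away from `s`. -/
theorem norm_sub_sum_monomialCLM_le (hπ : Function.Injective X.rep)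
    (hD : Dense (X.dirac.domain : Set H))
    (hT : IsCommutator (X.regularRepresentation α).dirac ((X.regularRepresentation α).rep b) T)
    {s : Finset ℤ} (hs : 0 ∈ s) {γ : ℝ} (hγ : 0 ≤ γ)
    (hsum : ∀ t : Finset ℤ, ∑ k ∈ t \ s, 1 / (k : ℝ) ^ 2 ≤ γ ^ 2) :
    ‖b - ∑ k ∈ s, monomialCLM α k (fourierCoeff α k b)‖ ≤ γ * ‖T‖ := by
  have hcol (m : ℤ) (t : Finset ℤ) :
      ∑ n ∈ t, ‖if n - m ∈ s then 0 else ((n - m : ℤ) : ℂ)⁻¹‖ ^ 2 ≤ γ ^ 2 := by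
    refine le_of_eq_of_le ?_ (hsum (t.map (Equiv.subRight m).toEmbedding))
    rw [Finset.sdiff_eq_filter, Finset.sum_filter, Finset.sum_map]
    refine Finset.sum_congr rfl fun n _ => ?_
    change _ = if n - m ∉ s then 1 / ((n - m : ℤ) : ℝ) ^ 2 else 0
    by_cases h : n - m ∈ s
    · rw [if_pos h, if_neg (not_not_intro h), norm_zero, zero_pow two_ne_zero]
    · rw [if_neg h, if_pos h, norm_inv, Complex.norm_intCast, inv_pow, sq_abs, one_div]
  have hentry (n m : ℤ) : matrixEntry (regRep α X.rep
      (b - ∑ k ∈ s, monomialCLM α k (fourierCoeff α k b))) n m =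
      (if n - m ∈ s then 0 else ((n - m : ℤ) : ℂ)⁻¹) •
        matrixEntry (jordanMul (ampliation (pauliY H)) T) n m := by
    have hb : matrixEntry ((X.regularRepresentation α).rep b) n m = _ :=
      matrixEntry_regRep α hπ b n m
    rw [matrixEntry_jordanMul_pauliY hπ hD hT, hb, matrixEntry_regRep α hπ,
      fourierCoeff_sub_sum_monomialCLM hπ]
    split_ifs with h
    · simp only [map_zero, zero_smul]
    · have hne : ((n - m : ℤ) : ℂ) ≠ 0 := Int.cast_ne_zero.mpr fun h₀ => h (h₀ ▸ hs)
      rw [inv_smul_smul₀ hne]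
  rw [← norm_regRep α hπ]
  exact (norm_le_of_matrixEntry_eq_smul hγ hcol hentry).trans
    (mul_le_mul_of_nonneg_left (norm_jordanMul_ampliation_pauliY_le T) hγ)

theorem exists_finset_norm_sub_sum_monomialCLM_le (hπ : Function.Injective X.rep)
    (hD : Dense (X.dirac.domain : Set H)) {ε : ℝ} (hε : 0 < ε) :
    ∃ s : Finset ℤ, ∀ b ∈ (X.regularRepresentation α).lipBall,
      ‖b - ∑ k ∈ s, monomialCLM α k (fourierCoeff α k b)‖ ≤ ε := by
  obtain ⟨s, hs, hsum⟩ := exists_finset_forall_sum_sdiff_le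
    (Real.summable_one_div_int_pow.mpr one_lt_two) {0} (pow_pos hε 2)
  refine ⟨s, fun b ⟨T, hT, hle⟩ => ?_⟩
  exact (norm_sub_sum_monomialCLM_le hπ hD hT (hs (Finset.mem_singleton_self 0)) hε.le
    hsum).trans (mul_le_of_le_one_right hε.le hle)

end Fourier

end SpectralData

namespace SpectralData

variable {A : Type*} [CStarAlgebra A] {H : Type*} [NormedAddCommGroup H]
  [InnerProductSpace ℂ H] [CompleteSpace H] {X : SpectralData A H} (α : A ≃⋆ₐ[ℂ] A)

theorem rep_one_regularRepresentation (h₁ : X.rep 1 = 1) :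
    (X.regularRepresentation α).rep 1 = 1 := by
  refine ContinuousLinearMap.ext fun f => lp.ext (funext fun n => ?_)
  change regRep α X.rep 1 f n = f n
  rw [← monomialCLM_zero_one, monomialCLM_apply, regRep_of, regRepFinite_monomial_apply,
    map_one, doubleRep_apply, h₁, sub_zero]
  rfl

theorem one_mem_commutant_regularRepresentation (h₁ : X.rep 1 = 1) :
    1 ∈ (X.regularRepresentation α).commutant := by
  change IsCommutator _ _ _
  rw [rep_one_regularRepresentation α h₁]
  exact isCommutator_one

variable {α}

theorem fourierCoeff_eq_zero_of_mem_commutant (hπ : Function.Injective X.rep)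
    (hD : Dense (X.dirac.domain : Set H)) {b : CrossedProductZ α}
    (hb : b ∈ (X.regularRepresentation α).commutant) {k : ℤ} (hk : k ≠ 0) :
    fourierCoeff α k b = 0 := by
  have h := abs_mul_norm_fourierCoeff_le hπ hD hb k
  rw [norm_zero] at h
  exact norm_le_zero_iff.mp
    (nonpos_of_mul_nonpos_right h (abs_pos.mpr (Int.cast_ne_zero.mpr hk)))

theorem fourierCoeff_mem_commutant (hπ : Function.Injective X.rep)
    (hD : Dense (X.dirac.domain : Set H)) {b : CrossedProductZ α}
    (hb : b ∈ (X.regularRepresentation α).commutant) (k : ℤ) :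
    fourierCoeff α k b ∈ X.commutant := by
  obtain ⟨S, hS, hle⟩ := exists_isCommutator_fourierCoeff hπ hD hb k
  rwa [norm_le_zero_iff.mp (hle.trans_eq norm_zero)] at hS

variable (α)

theorem commutant_regularRepresentation (hπ : Function.Injective X.rep)
    (hD : Dense (X.dirac.domain : Set H)) (h₁ : X.rep 1 = 1)
    (hX : X.commutant = Submodule.span ℂ {1}) :
    (X.regularRepresentation α).commutant = Submodule.span ℂ {1} := by
  refine le_antisymm (fun b hb => ?_) ((Submodule.span_singleton_le_iff_mem _ _).mpr
    (one_mem_commutant_regularRepresentation α h₁))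
  have hb₀ := fourierCoeff_mem_commutant hπ hD hb 0
  rw [hX, Submodule.mem_span_singleton] at hb₀
  obtain ⟨z, hz⟩ := hb₀
  refine Submodule.mem_span_singleton.mpr ⟨z, ext_fourierCoeff hπ fun k => ?_⟩
  rw [← monomialCLM_zero_one, ← map_smul, fourierCoeff_monomialCLM α hπ, hz]
  split_ifs with hk
  · rw [hk]
  · exact (fourierCoeff_eq_zero_of_mem_commutant hπ hD hb (Ne.symm hk)).symm

end SpectralData

section TotallyBounded

theorem totallyBounded_of_forall_exists_isCompact {E : Type*} [PseudoMetricSpace E] {s : Set E}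
    (h : ∀ ε > 0, ∃ K, IsCompact K ∧ ∀ x ∈ s, ∃ y ∈ K, dist x y ≤ ε) : TotallyBounded s := by
  refine Metric.totallyBounded_iff.mpr fun ε hε => ?_
  obtain ⟨K, hK, hs⟩ := h (ε / 2) (half_pos hε)
  obtain ⟨t, ht, hKt⟩ := Metric.totallyBounded_iff.mp hK.totallyBounded (ε / 2) (half_pos hε)
  refine ⟨t, ht, fun x hx => ?_⟩
  obtain ⟨y, hy, hxy⟩ := hs x hx
  obtain ⟨z, hz, hyz⟩ := Set.mem_iUnion₂.mp (hKt hy)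
  exact Set.mem_iUnion₂.mpr ⟨z, hz, (dist_triangle x y z).trans_lt
    ((add_lt_add_of_le_of_lt hxy hyz).trans_eq (add_halves ε))⟩

theorem norm_eq_zero_of_forall_norm_smul_le {𝕜 E : Type*} [NontriviallyNormedField 𝕜]
    [SeminormedAddCommGroup E] [NormedSpace 𝕜 E] {x : E} {R : ℝ}
    (h : ∀ c : 𝕜, ‖c • x‖ ≤ R) : ‖x‖ = 0 := by
  by_contra hx
  obtain ⟨c, hc⟩ := NormedField.exists_lt_norm 𝕜 (R / ‖x‖)
  rw [div_lt_iff₀ ((norm_nonneg x).lt_of_ne' hx), ← norm_smul] at hc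
  exact (h c).not_gt hc

variable {𝕜 E : Type*} [RCLike 𝕜] [NormedAddCommGroup E] [NormedSpace 𝕜 E]
  {S : Submodule 𝕜 E}

theorem mem_of_forall_smul_mkQ_mem [FiniteDimensional 𝕜 S] {C : Set (E ⧸ S)}
    (hC : Bornology.IsBounded C) {x : E} (hx : ∀ c : 𝕜, c • S.mkQ x ∈ C) : x ∈ S := by
  obtain ⟨R, hR⟩ := hC.exists_norm_le
  have h := norm_eq_zero_of_forall_norm_smul_le fun c => hR _ (hx c)
  have hS : IsClosed (S.toAddSubgroup : Set E) := S.closed_of_finiteDimensional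
  exact QuotientAddGroup.norm_mk_eq_zero.mp h

theorem totallyBounded_of_totallyBounded_image_mkQ [CompleteSpace E] [FiniteDimensional 𝕜 S]
    {s : Set E} (hs : Bornology.IsBounded s) (hmk : TotallyBounded (S.mkQ '' s)) :
    TotallyBounded s := by
  obtain ⟨P, hP⟩ := Submodule.ClosedComplemented.of_finiteDimensional S
  have := FiniteDimensional.proper_rclike 𝕜 S
  let σ : E ⧸ S →L[𝕜] E := S.liftQL (ContinuousLinearMap.id 𝕜 E - S.subtypeL ∘L P) fun x hx => by
    change x - (P x : E) = 0
    rw [hP ⟨x, hx⟩, sub_self]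
  have hP' : IsCompact (closure (P '' s)) := (P.lipschitz.isBounded_image hs).isCompact_closure
  have hσ : IsCompact (closure (S.mkQ '' s)) := hmk.closure.isCompact_of_isClosed isClosed_closure
  refine ((hP'.image S.subtypeL.continuous).add (hσ.image σ.continuous)).totallyBounded.subset
    fun x hx => ?_
  exact ⟨P x, ⟨P x, subset_closure ⟨x, hx, rfl⟩, rfl⟩, x - P x,
    ⟨S.mkQ x, subset_closure ⟨x, hx, rfl⟩, rfl⟩, add_sub_cancel _ _⟩

end TotallyBounded

section StrictlyPositive

theorem isUnit_of_isUnit_mul_mul {R : Type*} [Monoid R] {h a : R} (hu : IsUnit (h * a * h)) :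
    IsUnit h := by
  obtain ⟨u, hu⟩ := hu
  have hl : ↑u⁻¹ * h * a * h = 1 := by
    rw [mul_assoc, mul_assoc, ← mul_assoc h, ← hu, u.inv_mul]
  have hr : h * (a * h * ↑u⁻¹) = 1 := by
    rw [← mul_assoc, ← mul_assoc, ← hu, u.mul_inv]
  exact ⟨⟨h, a * h * ↑u⁻¹, hr, by rw [← left_inv_eq_right_inv hl hr, hl]⟩, rfl⟩

theorem IsStrictlyPositiveElement.isUnit {A : Type*} [CStarAlgebra A] {h : A}
    (hh : IsStrictlyPositiveElement h) : IsUnit h := by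
  obtain ⟨_, ⟨a, rfl⟩, ha⟩ := hh.2.exists_mem_open Units.isOpen ⟨1, isUnit_one⟩
  exact isUnit_of_isUnit_mul_mul ha

theorem isStrictlyPositiveElement_one {A : Type*} [CStarAlgebra A] :
    IsStrictlyPositiveElement (1 : A) := by
  refine ⟨⟨1, by rw [star_one, one_mul]⟩, ?_⟩
  simp only [one_mul, mul_one]
  exact Function.surjective_id.denseRange

theorem inv_mem_span_one {𝕜 A : Type*} [Field 𝕜] [Ring A] [Algebra 𝕜 A] {u : Aˣ}
    (hu : (u : A) ∈ Submodule.span 𝕜 {1}) : (↑u⁻¹ : A) ∈ Submodule.span 𝕜 {1} := by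
  obtain ⟨z, hz⟩ := Submodule.mem_span_singleton.mp hu
  have hinv : z • (↑u⁻¹ : A) = 1 := by rw [← u.mul_inv, ← hz, smul_one_mul]
  rcases eq_or_ne z 0 with rfl | hz₀
  · rw [zero_smul] at hinv
    rw [← mul_one (↑u⁻¹ : A), ← hinv, mul_zero]
    exact Submodule.zero_mem _
  · rw [eq_inv_smul_iff₀ hz₀ |>.mpr hinv]
    exact Submodule.smul_mem _ _ (Submodule.mem_span_singleton_self 1)

end StrictlyPositive

namespace SpectralData

variable {A : Type*} [CStarAlgebra A] {H : Type*} [NormedAddCommGroup H]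
  [InnerProductSpace ℂ H] [CompleteSpace H] {X : SpectralData A H}

theorem smul_one_mem_lipBall (h₁ : 1 ∈ X.commutant) (c : ℂ) : c • 1 ∈ X.lipBall := by
  have h := X.commutant.smul_mem c h₁
  exact ⟨0, h, norm_zero.trans_le zero_le_one⟩

/-- The compressed ball contains the line through `h²`, so `h²` is a scalar by precompactness,
and undoing the compression is a well-defined continuous map modulo scalars. -/
theorem totallyBounded_image_lipBall (hX : X.IsCompactSpectralMetricSpace) :
    TotallyBounded (X.commutant.mkQ '' X.lipBall) := by
  obtain ⟨h, hh, hC⟩ := hX.precompact_lipBall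
  obtain ⟨u, rfl⟩ := hh.isUnit
  have h₁ : 1 ∈ X.commutant := hX.commutant_eq ▸ Submodule.mem_span_singleton_self 1
  have hfin : FiniteDimensional ℂ X.commutant := by
    rw [hX.commutant_eq]
    infer_instance
  have hsq : ((u * u : Aˣ) : A) ∈ X.commutant :=
    mem_of_forall_smul_mkQ_mem hC.isBounded fun c => subset_closure
      ⟨_, ⟨c • 1, smul_one_mem_lipBall h₁ c, rfl⟩, by simp⟩
  rw [hX.commutant_eq] at hsq
  let L : A →L[ℂ] A := ContinuousLinearMap.mulLeftRight ℂ A ↑u⁻¹ ↑u⁻¹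
  have hL : X.commutant ≤ (X.commutant.mkQL ∘L L).ker := by
    rw [hX.commutant_eq, Submodule.span_singleton_le_iff_mem]
    refine (Submodule.Quotient.mk_eq_zero _).mpr ?_
    change (↑u⁻¹ * 1 * ↑u⁻¹ : A) ∈ _
    rw [mul_one, ← Units.val_mul, ← mul_inv_rev]
    exact inv_mem_span_one hsq
  refine (hC.image (X.commutant.liftQL _ hL).continuous).totallyBounded.subset ?_
  rintro _ ⟨a, ha, rfl⟩
  refine ⟨_, subset_closure ⟨_, ⟨a, ha, rfl⟩, rfl⟩, congrArg X.commutant.mkQ ?_⟩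
  change (↑u⁻¹ * (u * a * u) * ↑u⁻¹ : A) = a
  simp [mul_assoc]

end SpectralData

namespace SpectralData

section Compactness

variable {A : Type*} [CStarAlgebra A] {H : Type*} [NormedAddCommGroup H]
  [InnerProductSpace ℂ H] [CompleteSpace H] {X : SpectralData A H} {α : A ≃⋆ₐ[ℂ] A}

theorem fourierCoeff_mem_lipBall (hπ : Function.Injective X.rep)
    (hD : Dense (X.dirac.domain : Set H)) {b : CrossedProductZ α}
    (hb : b ∈ (X.regularRepresentation α).lipBall) (k : ℤ) : fourierCoeff α k b ∈ X.lipBall := by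
  obtain ⟨T, hT, hle⟩ := hb
  obtain ⟨S, hS, hS'⟩ := exists_isCommutator_fourierCoeff hπ hD hT k
  exact ⟨S, hS, hS'.trans hle⟩

theorem norm_fourierCoeff_le_one (hπ : Function.Injective X.rep)
    (hD : Dense (X.dirac.domain : Set H)) {b : CrossedProductZ α}
    (hb : b ∈ (X.regularRepresentation α).lipBall) {k : ℤ} (hk : k ≠ 0) :
    ‖fourierCoeff α k b‖ ≤ 1 := by
  obtain ⟨T, hT, hle⟩ := hb
  have hk₁ : (1 : ℝ) ≤ |(k : ℝ)| := mod_cast Int.one_le_abs hk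
  exact (le_mul_of_one_le_left (norm_nonneg _) hk₁).trans
    ((abs_mul_norm_fourierCoeff_le hπ hD hT k).trans hle)

variable (α)

theorem totallyBounded_image_fourierCoeff (hX : X.IsCompactSpectralMetricSpace) {k : ℤ}
    (hk : k ≠ 0) : TotallyBounded (fourierCoeff α k '' (X.regularRepresentation α).lipBall) := by
  have hD := hX.isSelfAdjoint.dense_domain
  have hfin : FiniteDimensional ℂ X.commutant := by
    rw [hX.commutant_eq]
    infer_instance
  refine totallyBounded_of_totallyBounded_image_mkQ (S := X.commutant)
    (Metric.isBounded_closedBall.subset (t := Metric.closedBall 0 1) ?_)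
    ((totallyBounded_image_lipBall hX).subset (Set.image_mono ?_))
  · rintro _ ⟨b, hb, rfl⟩
    exact mem_closedBall_zero_iff.mpr (norm_fourierCoeff_le_one hX.faithful hD hb hk)
  · rintro _ ⟨b, hb, rfl⟩
    exact fourierCoeff_mem_lipBall hX.faithful hD hb k

theorem totallyBounded_image_mkQL_monomialCLM_zero (hX : X.IsCompactSpectralMetricSpace) :
    TotallyBounded ((fun b => (X.regularRepresentation α).commutant.mkQL
      (monomialCLM α 0 (fourierCoeff α 0 b))) '' (X.regularRepresentation α).lipBall) := by
  have hker : X.commutant ≤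
      ((X.regularRepresentation α).commutant.mkQL ∘L monomialCLM α 0).ker := by
    rw [hX.commutant_eq, Submodule.span_singleton_le_iff_mem]
    exact (Submodule.Quotient.mk_eq_zero _).mpr
      (one_mem_commutant_regularRepresentation α (X.rep_one hX.nondegenerate))
  refine ((totallyBounded_image_lipBall hX).image
    (X.commutant.liftQL _ hker).uniformContinuous).subset ?_
  rintro _ ⟨b, hb, rfl⟩
  exact ⟨_, ⟨_, fourierCoeff_mem_lipBall hX.faithful hX.isSelfAdjoint.dense_domain hb 0, rfl⟩,
    rfl⟩

theorem totallyBounded_image_lipBall_regularRepresentation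
    (hX : X.IsCompactSpectralMetricSpace) :
    TotallyBounded ((X.regularRepresentation α).commutant.mkQ ''
      (X.regularRepresentation α).lipBall) := by
  let q := (X.regularRepresentation α).commutant.mkQL
  have hterm (k : ℤ) : TotallyBounded ((fun b => q (monomialCLM α k (fourierCoeff α k b))) ''
      (X.regularRepresentation α).lipBall) := by
    obtain rfl | hk := eq_or_ne k 0
    · exact totallyBounded_image_mkQL_monomialCLM_zero α hX
    · have h := (totallyBounded_image_fourierCoeff α hX hk).image
        (q ∘L monomialCLM α k).uniformContinuous
      rwa [Set.image_image] at h
  refine totallyBounded_of_forall_exists_isCompact fun ε hε => ?_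
  obtain ⟨s, hs⟩ := exists_finset_norm_sub_sum_monomialCLM_le (α := α) hX.faithful
    hX.isSelfAdjoint.dense_domain hε
  refine ⟨_, (isCompact_univ_pi fun k =>
    (hterm k).closure.isCompact_of_isClosed isClosed_closure).image
      (f := fun y => ∑ k ∈ s, y k) (by fun_prop), ?_⟩
  rintro _ ⟨b, hb, rfl⟩
  refine ⟨_, ⟨fun k => q (monomialCLM α k (fourierCoeff α k b)),
    fun k _ => subset_closure ⟨b, hb, rfl⟩, rfl⟩, ?_⟩
  change dist (q b) (∑ k ∈ s, q (monomialCLM α k (fourierCoeff α k b))) ≤ ε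
  rw [dist_eq_norm, ← map_sum, ← map_sub]
  exact (Submodule.Quotient.norm_mk_le _ _).trans (hs b hb)

end Compactness

end SpectralData

theorem isCommutator_l2Sum {E : Type*} [NormedAddCommGroup E] [InnerProductSpace ℂ E]
    {T : ℤ → E →ₗ.[ℂ] E} {b W : ℤ → E →L[ℂ] E} {σ : ℤ → ℤ}
    {B C : lp (fun _ : ℤ => E) 2 →L[ℂ] lp (fun _ : ℤ => E) 2}
    (h : ∀ n, IsGeneralizedCommutator (T n) (T (σ n)) (b n) (W n))
    (hB : ∀ f n, B f n = b n (f (σ n))) (hC : ∀ f n, C f n = W n (f (σ n))) :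
    IsCommutator (LinearPMap.l2Sum T) B C := fun f => by
  have hrow (n : ℤ) : ∃ hn : B f n ∈ (T n).domain,
      T n ⟨B f n, hn⟩ = (B (LinearPMap.l2Sum T f) + C f) n := by
    obtain ⟨hn, e⟩ := h n ⟨_, f.2.1 (σ n)⟩
    have hadd : (B (LinearPMap.l2Sum T f) + C f) n =
        b n (T (σ n) ⟨_, f.2.1 (σ n)⟩) + W n (f.1 (σ n)) :=
      congrArg₂ (· + ·) (hB _ n) (hC _ n)
    simp only [hB, hadd]
    exact ⟨hn, eq_add_of_sub_eq' e⟩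
  choose hdom heq using hrow
  have hmem : (B f : lp (fun _ : ℤ => E) 2) ∈ (LinearPMap.l2Sum T).domain :=
    ⟨hdom, (funext heq : (fun n => T n ⟨B f n, hdom n⟩) = _) ▸ lp.memℓp _⟩
  exact ⟨hmem, sub_eq_of_eq_add' (lp.ext (funext heq))⟩

namespace SpectralData

variable {A : Type*} [CStarAlgebra A] {H : Type*} [NormedAddCommGroup H]
  [InnerProductSpace ℂ H] [CompleteSpace H]

theorem norm_pauliX_mul_tensorOne_add_le (S c : H →L[ℂ] H) (k : ℂ) :
    ‖pauliX H * tensorOne H S + k • (pauliY H * tensorOne H c)‖ ≤ ‖S‖ + ‖k‖ * ‖c‖ := by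
  have hX : ‖pauliX H * tensorOne H S‖ ≤ ‖S‖ := (norm_mul_le _ _).trans
    ((mul_le_of_le_one_left (norm_nonneg _) norm_pauliX_le).trans_eq (norm_tensorOne S))
  have hY : ‖pauliY H * tensorOne H c‖ ≤ ‖c‖ := (norm_mul_le _ _).trans
    ((mul_le_of_le_one_left (norm_nonneg _) norm_pauliY_le).trans_eq (norm_tensorOne c))
  refine norm_add_le_of_le hX ?_
  rw [norm_smul]
  exact mul_le_mul_of_nonneg_left hY (norm_nonneg k)

variable {X : SpectralData A H} {α : A ≃⋆ₐ[ℂ] A}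

theorem monomialCLM_mem_C1 {a : A} (ha : a ∈ X.C1b (Subgroup.zpowers α)) (k : ℤ) :
    monomialCLM α k a ∈ (X.regularRepresentation α).C1 := by
  obtain ⟨C, hC⟩ := ha
  choose S hS hle using fun n : ℤ => hC (α ^ (-n)) (Subgroup.zpow_mem_zpowers α (-n))
  let W (n : ℤ) : WithLp 2 (H × H) →L[ℂ] WithLp 2 (H × H) :=
    pauliX H * tensorOne H (S n) +
      ((n - (n - k) : ℤ) : ℂ) • (pauliY H * tensorOne H (X.rep ((α ^ (-n)) a)))
  have hW (n : ℤ) : ‖W n‖ ≤ C + |(k : ℝ)| * ‖a‖ := by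
    refine (norm_pauliX_mul_tensorOne_add_le _ _ _).trans (add_le_add (hle n) ?_)
    rw [sub_sub_cancel, Complex.norm_intCast]
    exact mul_le_mul_of_nonneg_left ((NonUnitalStarAlgHom.norm_apply_le X.rep _).trans
      (StarAlgEquiv.norm_map (α ^ (-n)) a).le) (abs_nonneg _)
  refine ⟨lp.mapCLM 2 W ((norm_nonneg _).trans (hW 0)) hW ∘L shift H (Multiplicative.ofAdd k),
    isCommutator_l2Sum (σ := fun n => n - k)
      (fun n => isGeneralizedCommutator_diracBlock (hS n) n (n - k))
      (fun f n => ?_) fun _ _ => rfl⟩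
  change regRep α X.rep (monomialCLM α k a) f n = _
  rw [monomialCLM_apply, regRep_of, regRepFinite_monomial_apply]
  rfl

theorem dense_C1_regularRepresentation (hα : Dense (X.C1b (Subgroup.zpowers α))) :
    Dense (X.regularRepresentation α).C1 :=
  mem_of_monomialCLM_mem (W := (X.regularRepresentation α).C1Submodule.topologicalClosure)
    isClosed_closure fun k a => map_mem_closure (monomialCLM α k).continuous (hα a)
      fun _ hb => monomialCLM_mem_C1 hb k

variable (α) in
theorem isSpectralTriple_regularRepresentation (hX : X.IsSpectralTriple)
    (hα : Dense (X.C1b (Subgroup.zpowers α))) :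
    (X.regularRepresentation α).IsSpectralTriple where
  separable := by
    have := hX.separable
    exact separableSpace α
  faithful := regRep_injective α hX.faithful
  isSelfAdjoint := isSelfAdjoint_l2Sum fun n => isSelfAdjoint_diracBlock hX.isSelfAdjoint n
  compactResolvent := hasCompactResolvent_l2Sum_diracBlock hX.isSelfAdjoint hX.compactResolvent
  dense_C1 := dense_C1_regularRepresentation hα

variable (α) in
theorem isCompact_image_lipBall_regularRepresentation (hX : X.IsCompactSpectralMetricSpace) :
    IsCompact ((X.regularRepresentation α).commutant.mkQ ''
      (X.regularRepresentation α).lipBall) :=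
  (totallyBounded_image_lipBall_regularRepresentation α hX).isCompact_of_isClosed
    (isClosed_image_lipBall _
      (isSelfAdjoint_l2Sum fun n => isSelfAdjoint_diracBlock hX.isSelfAdjoint n))

theorem topologicalClosure_span_rep_eq_top (h₁ : X.rep 1 = 1) :
    (Submodule.span ℂ {y : H | ∃ a x, X.rep a x = y}).topologicalClosure = ⊤ :=
  eq_top_iff.mpr fun y _ => subset_closure
    (Submodule.subset_span ⟨1, y, congrArg (fun T : H →L[ℂ] H => T y) h₁⟩)

theorem precompact_lipBall_of_isCompact (h : IsCompact (X.commutant.mkQ '' X.lipBall)) :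
    ∃ h : A, IsStrictlyPositiveElement h ∧
      IsCompact (closure (X.commutant.mkQ '' ((fun a => h * a * h) '' X.lipBall))) := by
  refine ⟨1, isStrictlyPositiveElement_one, ?_⟩
  simp only [one_mul, mul_one, Set.image_id']
  exact h.closure

end SpectralData

theorem mainTheorem4_general {A : Type*} [CStarAlgebra A]
    {H : Type*} [NormedAddCommGroup H] [InnerProductSpace ℂ H] [CompleteSpace H]
    (X : SpectralData A H) (hX : X.IsCompactSpectralMetricSpace)
    (α : A ≃⋆ₐ[ℂ] A) (hα : Dense (X.C1b (Subgroup.zpowers α))) :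
    IsCompact ((X.regularRepresentation α).commutant.mkQ ''
        (X.regularRepresentation α).lipBall) ∧
      (X.regularRepresentation α).IsCompactSpectralMetricSpace := by
  have h₁ : X.rep 1 = 1 := X.rep_one hX.nondegenerate
  have hcompact := isCompact_image_lipBall_regularRepresentation α hX
  exact ⟨hcompact,
    { isSpectralTriple_regularRepresentation α hX.toIsSpectralTriple hα with
      nondegenerate :=
        topologicalClosure_span_rep_eq_top (rep_one_regularRepresentation α h₁)
      commutant_eq := commutant_regularRepresentation α hX.faithful
        hX.isSelfAdjoint.dense_domain h₁ hX.commutant_eq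
      precompact_lipBall := precompact_lipBall_of_isCompact hcompact }⟩

end

theorem mainTheorem4 {A : Type*} [CStarAlgebra A]
    {H : Type*} [NormedAddCommGroup H] [InnerProductSpace ℂ H] [CompleteSpace H]
    (X : SpectralData A H) (hX : X.IsCompactSpectralMetricSpace)
    (α : A ≃⋆ₐ[ℂ] A) (hα : X.IsEquicontinuous (Subgroup.zpowers α)) :
    IsCompact ((X.regularRepresentation α).commutant.mkQ ''
        (X.regularRepresentation α).lipBall) ∧
      (X.regularRepresentation α).IsCompactSpectralMetricSpace :=
  mainTheorem4_general X hX α (hα ▸ hX.dense_C1)
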